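/- Let $H$ be the real Heisenberg group, i.e. the group of the matrices $$\gamma(x,y,z)=\begin{pmatrix}1&x&z\\0&1&y\\0&0&1\end{pmatrix},\qquad x,y,z\in\mathbb R,$$ let $\Gamma=\{\gamma(a,b,c):a,b,c\in\mathbb Z\}$ and let $M=\Gamma\backslash H$. Let $g$ be the Riemannian metric on $M$ whose lift to $H$ is left-invariant and is given at the identity by the identity $3\times3$ matrix, i.e. is $dx^2+dy^2+(dz-x\,dy)^2$. Let $\alpha\in\mathbb R$, and let $\mathcal F$ be the one-dimensional foliation of $M$ by the orbits of the left-invariant vector field $X(1,\alpha,0)=\partial_x+\alpha(\partial_y+x\,\partial_z)$. Write $TM=F\oplus F^\perp$ with $F=T\mathcal F$ and $F^\perp$ its $g$-orthogonal complement, and $g=g_F+g_{F^\perp}$ accordingly; for $h>0$ put $g_h=g_F+h^{-2}g_{F^\perp}$. Let $\Delta_h\ge 0$ be the Laplace operator of $g_h$ on functions on $M$, let $0\le\lambda_0(h)\le\lambda_1(h)\le\cdots$ be its eigenvalues, counted with multiplicities, and for $t>0$ let $\operatorname{tr}e^{-t\Delta_h}=\sum_i e^{-t\lambda_i(h)}$.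 Then for every $t>0$ the trace $\operatorname{tr}e^{-t\Delta_h}$ is finite for all $h>0$, the integral below converges absolutely, and as $h\to0^+$ $$\operatorname{tr}e^{-t\Delta_h}=\frac{h^{-2}}{8\pi^2}\int_{-\infty}^{+\infty}\frac{\eta}{\sinh(t\eta)}\,e^{-t\eta^2}\,d\eta+o(h^{-2}).$$ -/

import Mathlib

open MeasureTheory Filter Topology Asymptotics
open scoped ENNReal ContDiff Matrix

noncomputable section

namespace HeisAdiabatic

/-! ### The Heisenberg group, the lattice and the nilmanifold -/

/-- The matrix `γ(x, y, z)`, with `(x, y, z) = (p 0, p 1, p 2)`. -/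
def heisMatrix (p : Fin 3 → ℝ) : Matrix (Fin 3) (Fin 3) ℝ :=
  !![1, p 0, p 2;
     0, 1, p 1;
     0, 0, 1]

/-- The matrix `X(x, y, z)` of the Lie algebra of the Heisenberg group. -/
def heisAlg (v : Fin 3 → ℝ) : Matrix (Fin 3) (Fin 3) ℝ :=
  !![0, v 0, v 2;
     0, 0, v 1;
     0, 0, 0]

theorem heisMatrix_mul (p q : Fin 3 → ℝ) :
    heisMatrix p * heisMatrix q
      = heisMatrix ![p 0 + q 0, p 1 + q 1, p 2 + q 2 + p 0 * q 1] := by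
  ext i j
  fin_cases i <;> fin_cases j <;> simp [heisMatrix, Matrix.mul_apply, Fin.sum_univ_three] <;> ring

theorem heisMatrix_zero : heisMatrix ![0, 0, 0] = 1 := by
  ext i j
  fin_cases i <;> fin_cases j <;> simp [heisMatrix]

/-- `γ(x, y, z)` as an element of `GL(3, ℝ)`. -/
def heisGL (p : Fin 3 → ℝ) : GL (Fin 3) ℝ where
  val := heisMatrix p
  inv := heisMatrix ![-p 0, -p 1, -p 2 + p 0 * p 1]
  val_inv := by
    rw [heisMatrix_mul, ← heisMatrix_zero]; congr 1
    ext i; fin_cases i <;> simp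
  inv_val := by
    rw [heisMatrix_mul, ← heisMatrix_zero]; congr 1
    ext i; fin_cases i <;> simp

theorem heisGL_mul (p q : Fin 3 → ℝ) :
    heisGL p * heisGL q = heisGL ![p 0 + q 0, p 1 + q 1, p 2 + q 2 + p 0 * q 1] :=
  Units.ext (heisMatrix_mul p q)

theorem heisGL_zero : heisGL ![0, 0, 0] = 1 :=
  Units.ext heisMatrix_zero

theorem heisGL_inv (p : Fin 3 → ℝ) :
    (heisGL p)⁻¹ = heisGL ![-p 0, -p 1, -p 2 + p 0 * p 1] :=
  Units.ext rfl

/-- The real three-dimensional Heisenberg group `H ⊆ GL(3, ℝ)`. -/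
def heisenbergGroup : Subgroup (GL (Fin 3) ℝ) where
  carrier := Set.range heisGL
  one_mem' := ⟨_, heisGL_zero⟩
  mul_mem' := by
    rintro _ _ ⟨p, rfl⟩ ⟨q, rfl⟩
    exact ⟨_, (heisGL_mul p q).symm⟩
  inv_mem' := by
    rintro _ ⟨p, rfl⟩
    exact ⟨_, (heisGL_inv p).symm⟩

/-- The global coordinates `(x, y, z) ↦ γ(x, y, z)` on `H`. -/
def gamma (p : Fin 3 → ℝ) : heisenbergGroup := ⟨heisGL p, p, rfl⟩

/-- The lattice `Γ = {γ(a, b, c) : a, b, c ∈ ℤ}` of `H`. -/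
def lattice : Subgroup heisenbergGroup where
  carrier := {g | ∃ a b c : ℤ, g = gamma ![(a : ℝ), (b : ℝ), (c : ℝ)]}
  one_mem' := ⟨0, 0, 0, Subtype.ext (by simpa [gamma] using heisGL_zero.symm)⟩
  mul_mem' := by
    rintro _ _ ⟨a, b, c, rfl⟩ ⟨a', b', c', rfl⟩
    refine ⟨a + a', b + b', c + c' + a * b', Subtype.ext ?_⟩
    have h := heisGL_mul ![(a : ℝ), (b : ℝ), (c : ℝ)] ![(a' : ℝ), (b' : ℝ), (c' : ℝ)]
    simpa [gamma] using h
  inv_mem' := by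
    rintro _ ⟨a, b, c, rfl⟩
    refine ⟨-a, -b, -c + a * b, Subtype.ext ?_⟩
    have h := heisGL_inv ![(a : ℝ), (b : ℝ), (c : ℝ)]
    simpa [gamma] using h

/-- The Heisenberg nilmanifold `Γ \ H`: the set of the cosets `Γ g`, `g ∈ H`. -/
abbrev Nilmanifold : Type := Quotient (QuotientGroup.rightRel lattice)

/-- The universal covering `ℝ³ → Γ \ H`, `(x, y, z) ↦ Γ γ(x, y, z)`. It is a smooth covering map,
so objects on `Γ \ H` are handled through their lifts to `ℝ³`. -/
def covering (p : Fin 3 → ℝ) : Nilmanifold := Quotient.mk _ (gamma p)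

/-! ### Metrics on `ℝ³` and the Laplace operator -/

/-- The coordinates of a strictly upper triangular matrix, the inverse of `heisAlg`. These are also
the coordinates of a tangent vector of `H` at `γ(p)`, viewed as a matrix: the differential of
`p ↦ γ(p)` is `heisAlg`. -/
def coords (A : Matrix (Fin 3) (Fin 3) ℝ) : Fin 3 → ℝ := ![A 0 1, A 1 2, A 0 2]

/-- The left-invariant vector field on `H` associated with `X(v)`, in the coordinates `(x, y, z)`:
its value at `γ(p)` is the tangent vector `γ(p) X(v)`. -/
def leftInvariantField (v p : Fin 3 → ℝ) : Fin 3 → ℝ := coords (heisMatrix p * heisAlg v)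

/-- The left-invariant metric on `H` whose value at the identity is given by the matrix `B`, in the
coordinates `(x, y, z)`: tangent vectors at `γ(p)` are moved to the identity by `γ(p)⁻¹`. -/
def leftInvariantMetric (B : Matrix (Fin 3) (Fin 3) ℝ) (p : Fin 3 → ℝ) :
    Matrix (Fin 3) (Fin 3) ℝ :=
  Matrix.of fun i j =>
    coords ((heisMatrix p)⁻¹ * heisAlg (Pi.single i 1)) ⬝ᵥ
      B *ᵥ coords ((heisMatrix p)⁻¹ * heisAlg (Pi.single j 1))

/-- The orthogonal projection of `v` to the line spanned by `X`, for the inner product `g`. -/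
def lineProj (g : Matrix (Fin 3) (Fin 3) ℝ) (X v : Fin 3 → ℝ) : Fin 3 → ℝ :=
  ((v ⬝ᵥ g *ᵥ X) / (X ⬝ᵥ g *ᵥ X)) • X

/-- The metric `g_h = g_F + h⁻² g_{F^⊥}` defined from a metric `g` and from the one-dimensional
foliation by the orbits of a vector field `X`: for `v = v_F + v_⊥` and `w = w_F + w_⊥` decomposed
along `F = ℝ X` and its `g`-orthogonal complement,
`g_h(v, w) = g(v_F, w_F) + h⁻² g(v_⊥, w_⊥)`. -/
def adiabaticMetric (g : (Fin 3 → ℝ) → Matrix (Fin 3) (Fin 3) ℝ)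
    (X : (Fin 3 → ℝ) → (Fin 3 → ℝ)) (h : ℝ) (p : Fin 3 → ℝ) : Matrix (Fin 3) (Fin 3) ℝ :=
  Matrix.of fun i j =>
    let P := lineProj (g p) (X p)
    let v : Fin 3 → ℝ := Pi.single i 1
    let w : Fin 3 → ℝ := Pi.single j 1
    P v ⬝ᵥ g p *ᵥ P w + (h ^ 2)⁻¹ * ((v - P v) ⬝ᵥ g p *ᵥ (w - P w))

/-- The partial derivative `∂u / ∂x_i`. -/
def partialDeriv (i : Fin 3) (u : (Fin 3 → ℝ) → ℂ) (p : Fin 3 → ℝ) : ℂ :=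
  fderiv ℝ u p (Pi.single i 1)

/-- The (nonnegative) Laplace operator of a Riemannian metric `g` on functions,
`Δ_g u = - (det g)^{-1/2} ∑_{i,j} ∂_i ((det g)^{1/2} g^{ij} ∂_j u)`. -/
def laplacian (g : (Fin 3 → ℝ) → Matrix (Fin 3) (Fin 3) ℝ) (u : (Fin 3 → ℝ) → ℂ)
    (p : Fin 3 → ℝ) : ℂ :=
  -((Real.sqrt (g p).det)⁻¹ •
    ∑ i, partialDeriv i
      (fun q => Real.sqrt (g q).det • ∑ j, (g q)⁻¹ i j • partialDeriv j u q) p)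

/-! ### Spectrum and heat trace in the adiabatic limit -/

/-- The lift to `ℝ³` of the metric `g_h` on `Γ \ H`, for the metric `g` given by the identity matrix
and for the foliation by the orbits of the left-invariant field `X(1, α, 0)`. -/
def heisMetric (α h : ℝ) : (Fin 3 → ℝ) → Matrix (Fin 3) (Fin 3) ℝ :=
  adiabaticMetric (leftInvariantMetric 1) (leftInvariantField ![1, α, 0]) h

/-- `f` is a smooth function on `Γ \ H` with `Δ_h f = ev f`. -/
def IsEigenfunction (α h ev : ℝ) (f : Nilmanifold → ℂ) : Prop :=
  ContDiff ℝ ∞ (f ∘ covering) ∧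
    ∀ p, laplacian (heisMetric α h) (f ∘ covering) p = (ev : ℂ) * f (covering p)

/-- The space of the solutions of `Δ_h f = ev f` on `Γ \ H` (these already form a linear space, so
that the span adds nothing). -/
def eigenspace (α h ev : ℝ) : Submodule ℂ (Nilmanifold → ℂ) :=
  Submodule.span ℂ {f | IsEigenfunction α h ev f}

/-- The multiplicity of `ev` in the spectrum of `Δ_h` (zero if `ev` is not an eigenvalue). -/
def multiplicity (α h ev : ℝ) : ℕ∞ :=
  Cardinal.toENat (Module.rank ℂ (eigenspace α h ev))

/-- The trace `tr e^{-tΔ_h} = ∑_i e^{-t λ_i(h)}`, the sum over the spectrum of `Δ_h` with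
multiplicities. -/
def heatTrace (α h t : ℝ) : ℝ≥0∞ :=
  ∑' ev : ℝ, (multiplicity α h ev : ℝ≥0∞) * ENNReal.ofReal (Real.exp (-t * ev))

end HeisAdiabatic

end

noncomputable section

namespace HeisAdiabatic

/-! ### Integrals depending smoothly on a parameter -/

/-! The spectrum of `Δ_h` can be computed exactly. A function on `Γ \ H` is a function on `ℝ³`
invariant under left translations by `Γ`, and `Δ_h` is minus a sum of squares of left-invariant
fields (`laplacian_eq_lap`): with `V = ∂_x + α Y`, `W = -α ∂_x + Y`, `Y = ∂_y + x ∂_z`, `Z = ∂_z`,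
it equals `-(V² + h² W²)/(1 + α²) - h² Z²`, where `[V, W] = (1 + α²) Z` and `Z` is central. Each
eigenspace splits into its Fourier modes `n` in `z`.

For `n = 0` only the characters of the base torus remain, with eigenvalues `torusEigenvalue`. For `n
≠ 0`, `Z` acts as `2πi n` and `Δ_h` is a harmonic oscillator: `P = V + iσh W` with `σ = -sign n` and
its companion `Q` move the spectrum by `2δ = 4π|n|h` (`isLadder`). As `Δ_h` has no negative
eigenvalues, the ladder starts at `ker P`. Solving the first-order equation `P u = 0` on Fourier
modes in `y` bounds the dimension of this kernel by `|n|`, and theta functions attain the bound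
(`dim_vacuum`). So the eigenvalues are `4π²n²h² + 2π|n|h(2j + 1)`, `j ≥ 0`, each contributing
multiplicity `|n|`.

No Hilbert space theory enters. The maximum principle (`exists_gradient_bound`) gives both the
nonnegativity of the spectrum and the finiteness of the set of modes in an eigenspace, so that all
dimension counts are algebraic.

Summing the geometric series in `j` gives `(4πh)⁻¹ ∑_n density t (2πhn)` (`tsum_oscillator`), a
Riemann sum of step `2πh`, hence asymptotic to `h⁻²/(8π²) ∫ density` (`tendsto_riemann`). The torus
part is a two-dimensional Gaussian sum in which only one direction is scaled by `h`; it is `O(h⁻¹)`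
(`exists_torusTrace_le`). -/

theorem hasFDerivAt_integral_of_contDiff {E F : Type} [NormedAddCommGroup E] [NormedSpace ℝ E]
    [ProperSpace E] [NormedAddCommGroup F] [NormedSpace ℝ F] [CompleteSpace F]
    {f : E × ℝ → F} (hf : ContDiff ℝ 1 f) (x : E) :
    HasFDerivAt (fun x => ∫ s in (0 : ℝ)..1, f (x, s))
      (∫ s in (0 : ℝ)..1, (fderiv ℝ f (x, s)).comp (ContinuousLinearMap.inl ℝ E ℝ)) x := by
  have hfd : Differentiable ℝ f := hf.differentiable one_ne_zero
  have hcont : Continuous fun q : E × ℝ =>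
      (fderiv ℝ f q).comp (ContinuousLinearMap.inl ℝ E ℝ) :=
    (hf.continuous_fderiv one_ne_zero).clm_comp continuous_const
  -- The derivative is continuous, hence bounded on the compact set `closedBall x 1 × [0, 1]`; this
  -- constant dominates.
  obtain ⟨C, hC⟩ := ((isCompact_closedBall x 1).prod (isCompact_Icc (a := (0 : ℝ)) (b := 1))
    ).exists_bound_of_continuousOn hcont.continuousOn
  refine (intervalIntegral.hasFDerivAt_integral_of_dominated_of_fderiv_le (μ := volume)
    (F := fun x s => f (x, s))
    (F' := fun x s => (fderiv ℝ f (x, s)).comp (ContinuousLinearMap.inl ℝ E ℝ))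
    (bound := fun _ => C)
    (Metric.closedBall_mem_nhds x one_pos) ?_ ?_ ?_ ?_ ?_ ?_)
  · exact Eventually.of_forall fun y =>
      (hf.continuous.comp (by fun_prop : Continuous fun s : ℝ => (y, s))).aestronglyMeasurable
  · exact (hf.continuous.comp (by fun_prop : Continuous fun s : ℝ => (x, s))).intervalIntegrable _ _
  · exact (hcont.comp (by fun_prop : Continuous fun s : ℝ => (x, s))).aestronglyMeasurable
  · refine Eventually.of_forall fun s hs y hy => hC (y, s) ⟨hy, ?_⟩
    rw [Set.uIoc_of_le zero_le_one] at hs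
    exact ⟨hs.1.le, hs.2⟩
  · exact intervalIntegrable_const
  · refine Eventually.of_forall fun s _ y _ => ?_
    exact (hfd (y, s)).hasFDerivAt.comp y (hasFDerivAt_prodMk_left y s)

/-- The target space is quantified inside the induction because the derivative of the integral is
again such an integral, with values in `E →L[ℝ] F`. -/
theorem contDiff_integral_nat {E : Type} [NormedAddCommGroup E] [NormedSpace ℝ E]
    [ProperSpace E] (n : ℕ) : ∀ {F : Type} [NormedAddCommGroup F] [NormedSpace ℝ F]
    [CompleteSpace F] {f : E × ℝ → F}, ContDiff ℝ n f →
    ContDiff ℝ n (fun x => ∫ s in (0 : ℝ)..1, f (x, s)) := by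
  induction n with
  | zero =>
    intro F _ _ _ f hf
    rw [Nat.cast_zero, contDiff_zero] at hf ⊢
    refine intervalIntegral.continuous_parametric_intervalIntegral_of_continuous'
      (f := fun x s => f (x, s)) ?_ 0 1
    exact hf
  | succ n ih =>
    intro F _ _ _ f hf
    have h1 : ContDiff ℝ 1 f := hf.of_le (by
      rw [Nat.cast_succ]; exact le_add_self)
    rw [Nat.cast_succ, contDiff_succ_iff_hasFDerivAt]
    refine ⟨_, ?_, fun x => hasFDerivAt_integral_of_contDiff h1 x⟩
    refine ih (f := fun q => (fderiv ℝ f q).comp (ContinuousLinearMap.inl ℝ E ℝ)) ?_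
    refine ContDiff.clm_comp ?_ contDiff_const
    exact hf.fderiv_right (by rw [Nat.cast_succ])

theorem contDiff_integral {E F : Type} [NormedAddCommGroup E] [NormedSpace ℝ E]
    [ProperSpace E] [NormedAddCommGroup F] [NormedSpace ℝ F] [CompleteSpace F]
    {f : E × ℝ → F} (hf : ContDiff ℝ ∞ f) :
    ContDiff ℝ ∞ (fun x => ∫ s in (0 : ℝ)..1, f (x, s)) := by
  rw [contDiff_infty]
  exact fun n => contDiff_integral_nat n (contDiff_infty.1 hf n)

/-! ### Smooth functions on `ℝ³` and operators on them -/

/-- The space of the smooth complex functions on `ℝ³`. -/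
def smoothFunctions : Submodule ℂ ((Fin 3 → ℝ) → ℂ) where
  carrier := {u | ContDiff ℝ ∞ u}
  zero_mem' := (contDiff_const : ContDiff ℝ ∞ fun _ : Fin 3 → ℝ => (0 : ℂ))
  add_mem' := fun {u w} (hu : ContDiff ℝ ∞ u) (hw : ContDiff ℝ ∞ w) => hu.add hw
  smul_mem' := fun c u (hu : ContDiff ℝ ∞ u) =>
    ((contDiff_const (c := c)).mul hu : ContDiff ℝ ∞ fun p => c * u p)

/-- Smooth complex functions on `ℝ³`. -/
abbrev Smooth : Type := smoothFunctions

theorem mem_smoothFunctions {u : (Fin 3 → ℝ) → ℂ} : u ∈ smoothFunctions ↔ ContDiff ℝ ∞ u :=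
  Iff.rfl

theorem Smooth.contDiff (u : Smooth) : ContDiff ℝ ∞ u.1 := mem_smoothFunctions.1 u.2

theorem Smooth.differentiable (u : Smooth) : Differentiable ℝ u.1 :=
  u.contDiff.differentiable (by simp)

theorem Smooth.continuous (u : Smooth) : Continuous u.1 := u.contDiff.continuous

theorem Smooth.differentiableAt (u : Smooth) (p : Fin 3 → ℝ) : DifferentiableAt ℝ u.1 p :=
  u.differentiable p

theorem contDiff_partialDeriv {u : (Fin 3 → ℝ) → ℂ} (hu : ContDiff ℝ ∞ u) (i : Fin 3) :
    ContDiff ℝ ∞ (partialDeriv i u) := by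
  unfold partialDeriv
  exact (hu.fderiv_right (m := ∞) (by simp)).clm_apply contDiff_const

/-- The operator `∂ / ∂x_i` on smooth functions. -/
def pd (i : Fin 3) : Module.End ℂ Smooth where
  toFun u := ⟨partialDeriv i u.1, mem_smoothFunctions.2 (contDiff_partialDeriv u.contDiff i)⟩
  map_add' u v := by
    ext p
    simp [partialDeriv, fderiv_add (u.differentiableAt p) (v.differentiableAt p)]
  map_smul' c u := by
    ext p
    simp [partialDeriv, fderiv_const_smul (u.differentiableAt p) c]

/-- The multiplication of smooth functions by the coordinate `x`. -/
def mulX : Module.End ℂ Smooth where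
  toFun u := ⟨fun p => (p 0 : ℂ) * u.1 p,
    mem_smoothFunctions.2
      ((Complex.ofRealCLM.contDiff.comp (contDiff_apply ℝ ℝ (0 : Fin 3))).mul u.contDiff)⟩
  map_add' u v := by ext p; simp [mul_add]
  map_smul' c u := by ext p; simp; ring

theorem pd_apply (i : Fin 3) (u : Smooth) (p : Fin 3 → ℝ) :
    (pd i u).1 p = fderiv ℝ u.1 p (Pi.single i 1) := rfl

theorem mulX_apply (u : Smooth) (p : Fin 3 → ℝ) : (mulX u).1 p = (p 0 : ℂ) * u.1 p := rfl

theorem pd_comm (i j : Fin 3) : pd i * pd j = pd j * pd i := by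
  ext u p
  have hsymm : IsSymmSndFDerivAt ℝ u.1 p :=
    (u.contDiff.contDiffAt).isSymmSndFDerivAt (by simp; exact WithTop.coe_le_coe.2 le_top)
  have key : ∀ a b : Fin 3, (pd a (pd b u)).1 p
      = fderiv ℝ (fderiv ℝ u.1) p (Pi.single a 1) (Pi.single b 1) := by
    intro a b
    have hd : DifferentiableAt ℝ (fderiv ℝ u.1) p :=
      (u.contDiff.fderiv_right (m := ∞) (by simp)).differentiable (by simp) p
    change fderiv ℝ (fun q => fderiv ℝ u.1 q (Pi.single b 1)) p (Pi.single a 1) = _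
    rw [fderiv_clm_apply hd (differentiableAt_const _)]
    simp
  change (pd i (pd j u)).1 p = (pd j (pd i u)).1 p
  rw [key, key, hsymm]

theorem pd_mulX_apply (i : Fin 3) (u : Smooth) (p : Fin 3 → ℝ) :
    (pd i (mulX u)).1 p
      = (if i = 0 then u.1 p else 0) + (p 0 : ℂ) * (pd i u).1 p := by
  have h0 : HasFDerivAt (fun q : Fin 3 → ℝ => (q 0 : ℂ))
      (Complex.ofRealCLM.comp (ContinuousLinearMap.proj 0)) p :=
    (Complex.ofRealCLM.comp (ContinuousLinearMap.proj (R := ℝ) (φ := fun _ : Fin 3 => ℝ) 0)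
      ).hasFDerivAt
  have := (h0.mul (u.differentiableAt p).hasFDerivAt).fderiv
  change fderiv ℝ (fun q => (q 0 : ℂ) * u.1 q) p (Pi.single i 1) = _
  rw [show (fun q => (q 0 : ℂ) * u.1 q) = (fun q : Fin 3 → ℝ => (q 0 : ℂ)) * u.1 from rfl, this]
  fin_cases i <;> simp [pd_apply, add_comm]

theorem pd_zero_mul_mulX : pd 0 * mulX = mulX * pd 0 + 1 := by
  ext u p
  change (pd 0 (mulX u)).1 p = (mulX (pd 0 u)).1 p + u.1 p
  rw [pd_mulX_apply, mulX_apply]; simp [add_comm]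

theorem pd_mul_mulX {i : Fin 3} (hi : i ≠ 0) : pd i * mulX = mulX * pd i := by
  ext u p
  change (pd i (mulX u)).1 p = (mulX (pd i u)).1 p
  rw [pd_mulX_apply, mulX_apply]; simp [hi]

/-- The operator on smooth functions given by the left-invariant field associated with `X(v)`. -/
def vf (v : Fin 3 → ℝ) : Module.End ℂ Smooth :=
  (v 0 : ℂ) • pd 0 + (v 1 : ℂ) • (pd 1 + mulX * pd 2) + (v 2 : ℂ) • pd 2

theorem leftInvariantField_eq (v p : Fin 3 → ℝ) :
    leftInvariantField v p = ![v 0, v 1, v 2 + p 0 * v 1] := by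
  ext i
  fin_cases i <;>
    simp [leftInvariantField, coords, heisMatrix, heisAlg, Matrix.mul_apply, Fin.sum_univ_three]

theorem fderiv_apply_eq (u : Smooth) (p v : Fin 3 → ℝ) :
    fderiv ℝ u.1 p v = (v 0 : ℂ) * (pd 0 u).1 p + (v 1 : ℂ) * (pd 1 u).1 p
      + (v 2 : ℂ) * (pd 2 u).1 p := by
  have hv : v = v 0 • Pi.single 0 1 + v 1 • Pi.single 1 1 + v 2 • Pi.single 2 1 := by
    ext i; fin_cases i <;> simp
  conv_lhs => rw [hv]
  simp [pd_apply]

theorem vf_apply (v : Fin 3 → ℝ) (u : Smooth) (p : Fin 3 → ℝ) :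
    (vf v u).1 p = (v 0 : ℂ) * (pd 0 u).1 p
      + (v 1 : ℂ) * ((pd 1 u).1 p + (p 0 : ℂ) * (pd 2 u).1 p) + (v 2 : ℂ) * (pd 2 u).1 p := rfl

theorem vf_apply_eq_fderiv (v : Fin 3 → ℝ) (u : Smooth) (p : Fin 3 → ℝ) :
    (vf v u).1 p = fderiv ℝ u.1 p (leftInvariantField v p) := by
  rw [fderiv_apply_eq, leftInvariantField_eq, vf_apply]
  simp
  ring

/-! ### Fourier modes along a direction -/

/-- The function `c ↦ exp(2πi c)`. -/
def ex (c : ℂ) : ℂ := Complex.exp (2 * Real.pi * Complex.I * c)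

theorem ex_add (a b : ℂ) : ex (a + b) = ex a * ex b := by
  rw [ex, ex, ex, ← Complex.exp_add]; congr 1; ring

theorem ex_zero : ex 0 = 1 := by simp [ex]

theorem ex_int (k : ℤ) : ex k = 1 := by
  rw [ex, mul_comm]; exact Complex.exp_int_mul_two_pi_mul_I k

theorem ex_ne_zero (a : ℂ) : ex a ≠ 0 := Complex.exp_ne_zero _

theorem contDiff_ex : ContDiff ℝ ∞ ex := by
  unfold ex
  exact (contDiff_const.mul contDiff_id).cexp

theorem continuous_ex : Continuous ex := contDiff_ex.continuous

theorem hasDerivAt_ex (a : ℂ) : HasDerivAt ex (2 * Real.pi * Complex.I * ex a) a := by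
  unfold ex
  have := ((hasDerivAt_id a).const_mul (2 * Real.pi * Complex.I : ℂ)).cexp
  simpa [mul_comm] using this

theorem modeProj_contDiff (v : Fin 3 → ℝ) (k : ℤ) (u : Smooth) :
    ContDiff ℝ ∞ fun p : Fin 3 → ℝ => ∫ s in (0 : ℝ)..1, ex (-(k * s)) * u.1 (p + s • v) := by
  refine contDiff_integral (f := fun q : (Fin 3 → ℝ) × ℝ => ex (-(k * q.2)) * u.1 (q.1 + q.2 • v)) ?_
  refine ContDiff.mul (contDiff_ex.comp ?_) (u.contDiff.comp ?_)
  · exact (contDiff_const.mul (Complex.ofRealCLM.contDiff.comp contDiff_snd)).neg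
  · exact contDiff_fst.add (contDiff_snd.smul contDiff_const)

theorem continuous_mode_integrand (v : Fin 3 → ℝ) (k : ℤ) (u : Smooth) (p : Fin 3 → ℝ) :
    Continuous fun s : ℝ => ex (-(k * s)) * u.1 (p + s • v) :=
  (continuous_ex.comp (by fun_prop)).mul (u.continuous.comp (by fun_prop))

/-- The `k`-th Fourier mode of a smooth function along the direction `v`. -/
def modeProj (v : Fin 3 → ℝ) (k : ℤ) : Module.End ℂ Smooth where
  toFun u := ⟨fun p => ∫ s in (0 : ℝ)..1, ex (-(k * s)) * u.1 (p + s • v),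
    mem_smoothFunctions.2 (modeProj_contDiff v k u)⟩
  map_add' u w := by
    ext p
    simp only [Submodule.coe_add, Pi.add_apply, mul_add]
    exact intervalIntegral.integral_add
      ((continuous_mode_integrand v k u p).intervalIntegrable _ _)
      ((continuous_mode_integrand v k w p).intervalIntegrable _ _)
  map_smul' c u := by
    ext p
    simp only [Submodule.coe_smul, Pi.smul_apply, smul_eq_mul, RingHom.id_apply]
    rw [← intervalIntegral.integral_const_mul]
    congr 1; ext s; ring

theorem modeProj_apply (v : Fin 3 → ℝ) (k : ℤ) (u : Smooth) (p : Fin 3 → ℝ) :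
    (modeProj v k u).1 p = ∫ s in (0 : ℝ)..1, ex (-(k * s)) * u.1 (p + s • v) := rfl

/-- Differentiation under the integral sign, together with the fact that `∂_i` commutes with
translations. -/
theorem modeProj_comm_pd (v : Fin 3 → ℝ) (k : ℤ) (i : Fin 3) :
    modeProj v k * pd i = pd i * modeProj v k := by
  ext u p
  change (modeProj v k (pd i u)).1 p = (pd i (modeProj v k u)).1 p
  have hf : ContDiff ℝ 1
      fun q : (Fin 3 → ℝ) × ℝ => ex (-(k * q.2)) * u.1 (q.1 + q.2 • v) := by
    refine ContDiff.mul ((contDiff_ex.of_le (by simp)).comp ?_)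
      ((u.contDiff.of_le (by simp)).comp ?_)
    · exact (contDiff_const.mul (Complex.ofRealCLM.contDiff.comp contDiff_snd)).neg
    · exact contDiff_fst.add (contDiff_snd.smul contDiff_const)
  have h := (hasFDerivAt_integral_of_contDiff hf p).fderiv
  have hint : ∀ s : ℝ, ((fderiv ℝ (fun q : (Fin 3 → ℝ) × ℝ =>
      ex (-(k * q.2)) * u.1 (q.1 + q.2 • v)) (p, s)).comp
        (ContinuousLinearMap.inl ℝ (Fin 3 → ℝ) ℝ)) (Pi.single i 1)
      = ex (-(k * s)) * (pd i u).1 (p + s • v) := by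
    intro s
    have h1 := HasFDerivAt.comp (f := fun x : Fin 3 → ℝ => (x, s)) p
      (hf.differentiable one_ne_zero (p, s)).hasFDerivAt (hasFDerivAt_prodMk_left p s)
    have h2 : HasFDerivAt (fun x : Fin 3 → ℝ => ex (-(k * s)) * u.1 (x + s • v))
        (ex (-(k * s)) • fderiv ℝ u.1 (p + s • v)) p := by
      have := (u.differentiableAt (p + s • v)).hasFDerivAt.comp p
        ((hasFDerivAt_id p).add_const (s • v))
      exact this.const_mul (ex (-(k * s)))
    rw [HasFDerivAt.unique h1 h2]
    simp [pd_apply]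
  rw [modeProj_apply, pd_apply]
  change _ = fderiv ℝ (fun p : Fin 3 → ℝ => ∫ s in (0 : ℝ)..1, ex (-(k * s)) * u.1 (p + s • v)) p _
  rw [h, ContinuousLinearMap.intervalIntegral_apply]
  · exact intervalIntegral.integral_congr fun s _ => (hint s).symm
  · refine Continuous.intervalIntegrable ?_ _ _
    exact ((hf.continuous_fderiv one_ne_zero).comp (by fun_prop)).clm_comp continuous_const

theorem modeProj_comm_mulX {v : Fin 3 → ℝ} (hv : v 0 = 0) (k : ℤ) :
    modeProj v k * mulX = mulX * modeProj v k := by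
  ext u p
  change (modeProj v k (mulX u)).1 p = (mulX (modeProj v k u)).1 p
  rw [mulX_apply, modeProj_apply, modeProj_apply, ← intervalIntegral.integral_const_mul]
  refine intervalIntegral.integral_congr fun s _ => ?_
  simp only [mulX_apply, Pi.add_apply, Pi.smul_apply, hv, smul_zero, add_zero]
  ring

theorem modeProj_comm_vf {v : Fin 3 → ℝ} (hv : v 0 = 0) (k : ℤ) (w : Fin 3 → ℝ) :
    modeProj v k * vf w = vf w * modeProj v k := by
  have h0 := modeProj_comm_pd v k 0
  have h1 := modeProj_comm_pd v k 1
  have h2 := modeProj_comm_pd v k 2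
  have hx := modeProj_comm_mulX hv k
  simp only [vf, mul_add, add_mul, mul_smul_comm, smul_mul_assoc, h0, h1, h2]
  rw [← mul_assoc, hx, mul_assoc, h2, mul_assoc]

/-- The functions of Fourier mode `k` along the direction `v`. -/
def isotypic (v : Fin 3 → ℝ) (k : ℤ) : Submodule ℂ Smooth where
  carrier := {u | ∀ p (s : ℝ), u.1 (p + s • v) = ex (k * s) * u.1 p}
  zero_mem' := fun p s => by simp
  add_mem' := fun {u w} hu hw p s => by simp [hu p s, hw p s, mul_add]
  smul_mem' := fun c u hu p s => by simp [hu p s]; ring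

/-- The functions of period `v`. -/
def periodic (v : Fin 3 → ℝ) : Submodule ℂ Smooth where
  carrier := {u | ∀ p, u.1 (p + v) = u.1 p}
  zero_mem' := fun p => by simp
  add_mem' := fun {u w} hu hw p => by simp [hu p, hw p]
  smul_mem' := fun c u hu p => by simp [hu p]

/-- A translation by `t • v` shifts the variable of integration, and the integral of a function of
period `1` is the same over every interval of length `1`. -/
theorem modeProj_mem_isotypic {v : Fin 3 → ℝ} {u : Smooth} (hu : u ∈ periodic v) (k : ℤ) :
    modeProj v k u ∈ isotypic v k := by
  intro p t
  rw [modeProj_apply, modeProj_apply, ← intervalIntegral.integral_const_mul]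
  have hper : Function.Periodic (fun s : ℝ => ex (-(k * s)) * u.1 (p + s • v)) 1 := by
    intro s
    have e1 : p + (s + 1) • v = (p + s • v) + v := by rw [add_smul, one_smul, add_assoc]
    have e2 : ex (-(k * ((s + 1 : ℝ) : ℂ))) = ex (-(k * s)) := by
      have : -(k * ((s + 1 : ℝ) : ℂ)) = -(k * s) + ((-k : ℤ) : ℂ) := by push_cast; ring
      rw [this, ex_add, ex_int, mul_one]
    simp only [e1, e2, hu (p + s • v)]
  have hshift : ∀ s : ℝ, ex (-(k * s)) * u.1 (p + t • v + s • v)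
      = (fun s : ℝ => ex (k * t) * (ex (-(k * s)) * u.1 (p + s • v))) (s + t) := by
    intro s
    have e1 : p + t • v + s • v = p + (s + t) • v := by rw [add_smul, add_assoc, add_comm (t • v)]
    simp only [e1]
    rw [← mul_assoc, ← ex_add]
    congr 2; push_cast; ring
  simp only [hshift]
  rw [intervalIntegral.integral_comp_add_right
    (fun s : ℝ => ex (k * t) * (ex (-(k * s)) * u.1 (p + s • v)))]
  rw [intervalIntegral.integral_const_mul, intervalIntegral.integral_const_mul]
  congr 1
  have := hper.intervalIntegral_add_eq t 0
  simpa [add_comm] using this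

theorem integral_ex_int (k : ℤ) : ∫ s in (0 : ℝ)..1, ex (k * s) = if k = 0 then 1 else 0 := by
  split_ifs with hk
  · simp [hk, ex_zero]
  · have hc : (2 * Real.pi * Complex.I * k : ℂ) ≠ 0 := by
      simp [Complex.I_ne_zero, Real.pi_ne_zero, hk]
    have : ∀ s : ℝ, ex (k * s) = Complex.exp ((2 * Real.pi * Complex.I * k) * s) := by
      intro s; rw [ex]; congr 1; ring
    simp only [this]
    rw [integral_exp_mul_complex hc]
    have h1 : Complex.exp (2 * Real.pi * Complex.I * k * (1 : ℝ)) = 1 := by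
      have := ex_int k; rw [ex] at this; simpa using this
    rw [h1]; simp

theorem modeProj_of_mem_isotypic {v : Fin 3 → ℝ} {u : Smooth} {m : ℤ} (hu : u ∈ isotypic v m)
    (k : ℤ) : modeProj v k u = if k = m then u else 0 := by
  ext p
  rw [modeProj_apply]
  have : ∀ s : ℝ, ex (-(k * s)) * u.1 (p + s • v) = ex ((m - k : ℤ) * s) * u.1 p := by
    intro s
    rw [hu p s, ← mul_assoc, ← ex_add]
    congr 2; push_cast; ring
  simp only [this]
  rw [intervalIntegral.integral_mul_const, integral_ex_int]
  by_cases h : k = m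
  · simp [h]
  · have h' : ¬ (m - k = 0) := by omega
    rw [if_neg h, if_neg h']; simp

/-- Vanishing Fourier coefficients are summable, so the Fourier series of a continuous function
converges pointwise to it, and the series is zero. -/
theorem eq_zero_of_integral_ex_eq_zero {g : ℝ → ℂ} (hg : Continuous g)
    (hper : Function.Periodic g 1)
    (h : ∀ k : ℤ, ∫ s in (0 : ℝ)..1, ex (-(k * s)) * g s = 0) (s : ℝ) : g s = 0 := by
  have : Fact ((0 : ℝ) < 1) := ⟨one_pos⟩
  have hG : Continuous (hper.lift : AddCircle (1 : ℝ) → ℂ) :=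
    continuous_coinduced_dom.2 hg
  let G : C(AddCircle (1 : ℝ), ℂ) := ⟨hper.lift, hG⟩
  have hcoef : ∀ k, fourierCoeff G k = 0 := by
    intro k
    rw [fourierCoeff_eq_intervalIntegral G k 0]
    have : ∀ s : ℝ, fourier (-k) (s : AddCircle (1 : ℝ)) • G (s : AddCircle (1 : ℝ))
        = ex (-(k * s)) * g s := by
      intro s
      rw [fourier_coe_apply, smul_eq_mul, ex]
      congr 2
      push_cast; ring
    simp only [this, zero_add, h k, smul_zero]
  have hsum : Summable (fourierCoeff G) := by
    have : fourierCoeff G = 0 := funext hcoef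
    rw [this]; exact summable_zero
  have h1 := has_pointwise_sum_fourier_series_of_summable hsum (s : AddCircle (1 : ℝ))
  simp only [hcoef, zero_smul] at h1
  exact h1.unique hasSum_zero

theorem eq_zero_of_modeProj_eq_zero {v : Fin 3 → ℝ} {u : Smooth} (hu : u ∈ periodic v)
    (h : ∀ k, modeProj v k u = 0) : u = 0 := by
  ext p
  have hper : Function.Periodic (fun s : ℝ => u.1 (p + s • v)) 1 := by
    intro s
    have e1 : p + (s + 1) • v = (p + s • v) + v := by rw [add_smul, one_smul, add_assoc]
    simp only [e1, hu (p + s • v)]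
  have := eq_zero_of_integral_ex_eq_zero (g := fun s : ℝ => u.1 (p + s • v))
    (u.continuous.comp (by fun_prop)) hper (fun k => by
      have := congrArg (fun w : Smooth => w.1 p) (h k)
      simpa [modeProj_apply] using this) 0
  simpa using this

/-! ### The Laplace operator in terms of left-invariant fields -/

theorem leftInvariantMetric_one (p : Fin 3 → ℝ) :
    leftInvariantMetric 1 p = !![1, 0, 0; 0, 1 + p 0 ^ 2, -p 0; 0, -p 0, 1] := by
  have hinv : (heisMatrix p)⁻¹ = heisMatrix ![-p 0, -p 1, -p 2 + p 0 * p 1] := by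
    refine Matrix.inv_eq_right_inv ?_
    rw [heisMatrix_mul, ← heisMatrix_zero]; congr 1
    ext i; fin_cases i <;> simp
  rw [leftInvariantMetric, hinv]
  ext i j
  fin_cases i <;> fin_cases j <;>
    simp [ coords, heisMatrix, heisAlg, Matrix.mul_apply,
      Fin.sum_univ_three, dotProduct]
  ring

/-- Because `g_h = h⁻² g + (1 - h⁻²) g_F`, and `g_F` is the square of the covector `(dx + α dy)/√(1
+ α²)`, dual to the unit vector along the leaves. -/
theorem heisMetric_eq (α h : ℝ) (p : Fin 3 → ℝ) :
    heisMetric α h p = (h ^ 2)⁻¹ • !![1, 0, 0; 0, 1 + p 0 ^ 2, -p 0; 0, -p 0, 1]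
      + ((1 - (h ^ 2)⁻¹) / (1 + α ^ 2)) • !![1, α, 0; α, α ^ 2, 0; 0, 0, 0] := by
  have hc : 1 + α ^ 2 ≠ 0 := by positivity
  have hlp : ∀ v : Fin 3 → ℝ, lineProj (leftInvariantMetric 1 p)
      (leftInvariantField ![1, α, 0] p) v
      = ((v 0 + α * v 1) / (1 + α ^ 2)) • ![1, α, p 0 * α] := by
    intro v
    rw [lineProj, leftInvariantMetric_one, leftInvariantField_eq]
    have e1 : v ⬝ᵥ !![1, 0, 0; 0, 1 + p 0 ^ 2, -p 0; 0, -p 0, 1] *ᵥ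
        ![(![1, α, 0] : Fin 3 → ℝ) 0, (![1, α, 0] : Fin 3 → ℝ) 1,
          (![1, α, 0] : Fin 3 → ℝ) 2 + p 0 * (![1, α, 0] : Fin 3 → ℝ) 1] = v 0 + α * v 1 := by
      simp [dotProduct, Matrix.mulVec, Fin.sum_univ_three]; ring
    have e2 : (![1, α, p 0 * α] : Fin 3 → ℝ) ⬝ᵥ
        !![1, 0, 0; 0, 1 + p 0 ^ 2, -p 0; 0, -p 0, 1] *ᵥ ![1, α, p 0 * α] = 1 + α ^ 2 := by
      simp [dotProduct, Matrix.mulVec, Fin.sum_univ_three]; ring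
    rw [e1]
    simp only [Matrix.cons_val_zero, Matrix.cons_val_one, Matrix.cons_val, zero_add]
    rw [e2]
  ext i j
  simp only [heisMetric, adiabaticMetric, Matrix.of_apply, hlp]
  rw [leftInvariantMetric_one]
  fin_cases i <;> fin_cases j <;>
    simp [dotProduct, Matrix.mulVec, Fin.sum_univ_three] <;> field_simp <;> first | ring1 | simp

theorem det_heisMetric (α : ℝ) {h : ℝ} (hh : h ≠ 0) (p : Fin 3 → ℝ) :
    (heisMetric α h p).det = (h ^ 4)⁻¹ := by
  have hc : 1 + α ^ 2 ≠ 0 := by positivity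
  rw [heisMetric_eq, Matrix.det_fin_three]
  simp
  field_simp
  ring

/-- The inverse metric is the sum of the squares of a `g_h`-orthonormal frame: `V/√(1 + α²)`, `h
W/√(1 + α²)` and `h ∂_z`. -/
theorem inv_heisMetric (α : ℝ) {h : ℝ} (hh : h ≠ 0) (p : Fin 3 → ℝ) :
    (heisMetric α h p)⁻¹ = (1 + α ^ 2)⁻¹ • Matrix.vecMulVec ![1, α, α * p 0] ![1, α, α * p 0]
      + (h ^ 2 / (1 + α ^ 2)) • Matrix.vecMulVec ![-α, 1, p 0] ![-α, 1, p 0]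
      + h ^ 2 • Matrix.vecMulVec ![0, 0, 1] ![0, 0, 1] := by
  have hc : 1 + α ^ 2 ≠ 0 := by positivity
  refine Matrix.inv_eq_right_inv ?_
  rw [heisMetric_eq]
  ext i j
  fin_cases i <;> fin_cases j <;>
    simp [Matrix.mul_apply, Fin.sum_univ_three] <;> field_simp <;> ring

/-- The Laplace operator `Δ_h` on smooth functions. -/
def lap (α h : ℝ) : Module.End ℂ Smooth :=
  -(((1 + (α : ℂ) ^ 2)⁻¹ : ℂ) • (vf ![1, α, 0] * vf ![1, α, 0])
    + (h ^ 2 / (1 + α ^ 2) : ℂ) • (vf ![-α, 1, 0] * vf ![-α, 1, 0])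
    + (h ^ 2 : ℂ) • (pd 2 * pd 2))

/-- The volume density is constant and the coordinate divergence of each frame field is zero (`∂_x`
and `∂_y` have constant coefficients, that of `∂_z` depends on `x` only), so the divergence form of
the Laplacian is minus the sum of the squares of the frame. -/
theorem laplacian_eq_lap (α : ℝ) {h : ℝ} (hh : h ≠ 0) (u : Smooth) (p : Fin 3 → ℝ) :
    laplacian (heisMetric α h) u.1 p = (lap α h u).1 p := by
  have hc : (1 + (α : ℂ) ^ 2) ≠ 0 := by
    have : (1 + α ^ 2 : ℝ) ≠ 0 := by positivity
    exact_mod_cast this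
  set K : ℝ := Real.sqrt ((h ^ 4)⁻¹) with hK
  have hK0 : (K : ℂ) ≠ 0 := by
    have : 0 < K := Real.sqrt_pos.2 (by positivity)
    exact_mod_cast this.ne'
  let V := vf ![1, α, 0] u
  let W := vf ![-α, 1, 0] u
  -- The components of `√det g · g⁻¹ du`, written through `V` and `W` so that they are visibly
  -- smooth; the last one carries the coefficient `x`, which `∂_z` does not see.
  let row : Fin 3 → Smooth := ![
    (K * (1 + (α : ℂ) ^ 2)⁻¹ : ℂ) • V - (K * (α * (h ^ 2 / (1 + α ^ 2))) : ℂ) • W,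
    (K * (α * (1 + (α : ℂ) ^ 2)⁻¹) : ℂ) • V + (K * (h ^ 2 / (1 + α ^ 2)) : ℂ) • W,
    mulX ((K * (α * (1 + (α : ℂ) ^ 2)⁻¹) : ℂ) • V + (K * (h ^ 2 / (1 + α ^ 2)) : ℂ) • W)
      + (K * h ^ 2 : ℂ) • pd 2 u]
  have hrow : ∀ i, (fun q => Real.sqrt (heisMetric α h q).det •
      ∑ j, (heisMetric α h q)⁻¹ i j • partialDeriv j u.1 q) = (row i).1 := by
    intro i
    ext q
    have hp : ∀ j, partialDeriv j u.1 q = (pd j u).1 q := fun _ => rfl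
    simp only [det_heisMetric α hh, inv_heisMetric α hh, ← hK, hp]
    have hV : V.1 q = (pd 0 u).1 q + α * ((pd 1 u).1 q + q 0 * (pd 2 u).1 q) := by
      simp [V, vf_apply]
    have hW : W.1 q = -α * (pd 0 u).1 q + ((pd 1 u).1 q + q 0 * (pd 2 u).1 q) := by
      simp [W, vf_apply]
    fin_cases i <;>
      simp [row, hV, hW, mulX_apply, Fin.sum_univ_three,
        -smul_add] <;> field_simp <;> ring
  have hpd : ∀ (i : Fin 3) (w : Smooth) (p), partialDeriv i w.1 p = (pd i w).1 p :=
    fun _ _ _ => rfl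
  unfold laplacian
  simp only [hrow]
  simp only [det_heisMetric α hh, ← hK, hpd, Fin.sum_univ_three]
  have hV : ∀ q, (vf ![1, α, 0] V).1 q
      = (pd 0 V).1 q + α * ((pd 1 V).1 q + q 0 * (pd 2 V).1 q) := by
    intro q; simp [vf_apply]
  have hW : ∀ q, (vf ![-α, 1, 0] W).1 q
      = -α * (pd 0 W).1 q + ((pd 1 W).1 q + q 0 * (pd 2 W).1 q) := by
    intro q; simp [vf_apply]
  have hlap : (lap α h u).1 p = -(((1 + (α : ℂ) ^ 2)⁻¹ : ℂ) * (vf ![1, α, 0] V).1 p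
    + (h ^ 2 / (1 + α ^ 2) : ℂ) * (vf ![-α, 1, 0] W).1 p
    + (h ^ 2 : ℂ) * (pd 2 (pd 2 u)).1 p) := rfl
  rw [hlap, hV, hW]
  have hm : ∀ w : Smooth, (pd 2 (mulX w)).1 p = p 0 * (pd 2 w).1 p := by
    intro w; rw [pd_mulX_apply]; simp
  simp [row, hm]
  field_simp
  ring

/-! ### Left translations and flows -/

/-- The left translation `γ(p) ↦ γ(a) γ(p)` in coordinates. -/
def leftTrans (a p : Fin 3 → ℝ) : Fin 3 → ℝ := ![a 0 + p 0, a 1 + p 1, a 2 + p 2 + a 0 * p 1]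

/-- The flow of the left-invariant field associated with `X(v)`. -/
def flow (v p : Fin 3 → ℝ) (s : ℝ) : Fin 3 → ℝ :=
  ![p 0 + s * v 0, p 1 + s * v 1, p 2 + s * (v 2 + p 0 * v 1) + s ^ 2 * (v 0 * v 1) / 2]

theorem flow_zero (v p : Fin 3 → ℝ) : flow v p 0 = p := by
  ext i; fin_cases i <;> simp [flow]

/-- The flow is right multiplication by `exp(s X(v))`, whence the term in `s²`, and it therefore
commutes with left translations. -/
theorem flow_leftTrans (v a p : Fin 3 → ℝ) (s : ℝ) :
    flow v (leftTrans a p) s = leftTrans a (flow v p s) := by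
  ext i; fin_cases i <;> simp [flow, leftTrans] <;> ring

theorem hasDerivAt_flow (v p : Fin 3 → ℝ) (s : ℝ) :
    HasDerivAt (flow v p) (leftInvariantField v (flow v p s)) s := by
  rw [hasDerivAt_pi, leftInvariantField_eq]
  intro i
  have hs := hasDerivAt_id s
  fin_cases i
  · simpa [flow] using (hs.mul_const (v 0)).const_add (p 0)
  · simpa [flow] using (hs.mul_const (v 1)).const_add (p 1)
  · have := ((hs.mul_const (v 2 + p 0 * v 1)).const_add (p 2)).add
      (((hs.pow 2).mul_const (v 0 * v 1)).div_const 2)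
    refine (this.congr_deriv ?_)
    simp [flow]; ring

theorem hasDerivAt_comp_flow (v : Fin 3 → ℝ) (u : Smooth) (p : Fin 3 → ℝ) (s : ℝ) :
    HasDerivAt (fun s => u.1 (flow v p s)) ((vf v u).1 (flow v p s)) s := by
  rw [vf_apply_eq_fderiv]
  exact (u.differentiableAt _).hasFDerivAt.comp_hasDerivAt s (hasDerivAt_flow v p s)

/-- Differentiating the hypothesis along the flow, which commutes with the left translation. The
factor `c` covers both invariance (`c = 1`) and characters. -/
theorem vf_leftTrans {v a : Fin 3 → ℝ} {u : Smooth} {c : ℂ}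
    (hu : ∀ p, u.1 (leftTrans a p) = c * u.1 p) (p : Fin 3 → ℝ) :
    (vf v u).1 (leftTrans a p) = c * (vf v u).1 p := by
  have h1 := hasDerivAt_comp_flow v u (leftTrans a p) 0
  simp only [flow_leftTrans, hu, flow_zero] at h1
  have h2 := (hasDerivAt_comp_flow v u p 0).const_mul c
  rw [flow_zero] at h2
  exact h1.unique h2

/-- The smooth functions on `ℝ³` that are lifts of functions on `Γ \ H`. -/
def invariants : Submodule ℂ Smooth where
  carrier := {u | ∀ (a b c : ℤ) (p), u.1 (leftTrans ![a, b, c] p) = u.1 p}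
  zero_mem' := fun a b c p => by simp
  add_mem' := fun {u w} hu hw a b c p => by simp [hu a b c p, hw a b c p]
  smul_mem' := fun c u hu a b c p => by simp [hu a b c p]

theorem vf_mem_invariants (v : Fin 3 → ℝ) {u : Smooth} (hu : u ∈ invariants) :
    vf v u ∈ invariants := by
  intro a b c p
  have := vf_leftTrans (v := v) (u := u) (a := ![a, b, c]) (c := 1) (by simpa using hu a b c) p
  simpa using this

theorem leftTrans_e2 (p : Fin 3 → ℝ) (s : ℝ) :
    leftTrans ![0, 0, s] p = p + s • (Pi.single 2 1) := by
  ext i; fin_cases i <;> simp [leftTrans, add_comm]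

theorem leftTrans_e1 (p : Fin 3 → ℝ) (s : ℝ) :
    leftTrans ![0, s, 0] p = p + s • (Pi.single 1 1) := by
  ext i; fin_cases i <;> simp [leftTrans, add_comm]

/-- Translations along `y` and `z` are left translations, by `γ(0, s, 0)` and `γ(0, 0, s)`; those
along `x` are not. -/
theorem vf_mem_isotypic (v : Fin 3 → ℝ) {i : Fin 3} (hi : i ≠ 0) {k : ℤ} {u : Smooth}
    (hu : u ∈ isotypic (Pi.single i 1) k) : vf v u ∈ isotypic (Pi.single i 1) k := by
  intro p s
  fin_cases i
  · exact absurd rfl hi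
  · have := vf_leftTrans (v := v) (u := u) (a := ![0, s, 0]) (c := ex (k * s))
      (fun p => by rw [leftTrans_e1]; exact hu p s) p
    rwa [leftTrans_e1] at this
  · have := vf_leftTrans (v := v) (u := u) (a := ![0, 0, s]) (c := ex (k * s))
      (fun p => by rw [leftTrans_e2]; exact hu p s) p
    rwa [leftTrans_e2] at this

theorem hasDerivAt_line (u : Smooth) (p : Fin 3 → ℝ) (i : Fin 3) :
    HasDerivAt (fun s : ℝ => u.1 (p + s • Pi.single i 1)) ((pd i u).1 p) 0 := by
  have hl : HasDerivAt (fun s : ℝ => p + s • (Pi.single i 1 : Fin 3 → ℝ)) (Pi.single i 1) 0 := by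
    simpa using ((hasDerivAt_id (0 : ℝ)).smul_const (Pi.single i 1 : Fin 3 → ℝ)).const_add p
  have := (u.differentiableAt (p + (0 : ℝ) • Pi.single i 1)).hasFDerivAt.comp_hasDerivAt
    (0 : ℝ) hl
  rw [zero_smul, add_zero] at this
  exact this

theorem pd_of_mem_isotypic {i : Fin 3} {k : ℤ} {u : Smooth}
    (hu : u ∈ isotypic (Pi.single i 1) k) : pd i u = (2 * Real.pi * Complex.I * k : ℂ) • u := by
  ext p
  have h1 := hasDerivAt_line u p i
  have h2 : HasDerivAt (fun s : ℝ => ex (k * s) * u.1 p)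
      ((2 * Real.pi * Complex.I * k : ℂ) * u.1 p) 0 := by
    have hl : HasDerivAt (fun s : ℝ => (k * s : ℂ)) (k * 1) 0 :=
      (Complex.ofRealCLM.hasDerivAt (x := (0 : ℝ))).const_mul (k : ℂ)
    have := ((hasDerivAt_ex (k * (0 : ℝ))).comp (0 : ℝ) hl).mul_const (u.1 p)
    simpa [ex_zero] using this
  have hEq : (fun s : ℝ => u.1 (p + s • Pi.single i 1)) = fun s : ℝ => ex (k * s) * u.1 p :=
    funext fun s => hu p s
  rw [hEq] at h1
  exact h1.unique h2

/-! ### The maximum principle -/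

theorem exists_leftTrans_mem_Icc (p : Fin 3 → ℝ) :
    ∃ a b c : ℤ, leftTrans ![a, b, c] p ∈ Set.Icc (0 : Fin 3 → ℝ) 1 := by
  -- The coordinate `z` is reduced after the translation in `x`, which has changed it by `a y` with
  -- `a = -⌊x⌋`.
  refine ⟨-⌊p 0⌋, -⌊p 1⌋, -⌊p 2 + (-⌊p 0⌋ : ℤ) * p 1⌋, ?_⟩
  have key : ∀ x : ℝ, 0 ≤ -(⌊x⌋ : ℝ) + x ∧ -(⌊x⌋ : ℝ) + x ≤ 1 := fun x =>
    ⟨by linarith [Int.floor_le x], by linarith [Int.lt_floor_add_one x]⟩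
  have h0 := key (p 0)
  have h1 := key (p 1)
  have h2 := key (p 2 + (-⌊p 0⌋ : ℤ) * p 1)
  push_cast at h2
  simp only [neg_mul] at h2
  constructor <;> intro i <;> fin_cases i <;> simp [leftTrans]
  · linarith
  · linarith
  · linarith [h2.1]
  · linarith
  · linarith
  · linarith [h2.2]

theorem exists_norm_max {u : Smooth} (hu : u ∈ invariants) : ∃ p, ∀ q, ‖u.1 q‖ ≤ ‖u.1 p‖ := by
  obtain ⟨p, -, hp⟩ := (isCompact_Icc (a := (0 : Fin 3 → ℝ)) (b := 1)).exists_isMaxOn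
    ⟨0, by simp⟩ (u.continuous.norm.continuousOn)
  refine ⟨p, fun q => ?_⟩
  obtain ⟨a, b, c, hq⟩ := exists_leftTrans_mem_Icc q
  have h : ‖u.1 (leftTrans ![a, b, c] q)‖ ≤ ‖u.1 p‖ := hp hq
  rwa [hu a b c q] at h

/-- If `f'' > 0` at the maximum, then `x` is also a local minimum, so `f` is locally constant there
and `f'' = 0`. -/
theorem deriv_deriv_nonpos_of_isMax {f f' : ℝ → ℝ} {f'' x : ℝ} (hf : ∀ s, HasDerivAt f (f' s) s)
    (hf' : HasDerivAt f' f'' x) (hmax : ∀ s, f s ≤ f x) : f'' ≤ 0 := by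
  by_contra! hpos
  have hd : deriv f = f' := funext fun s => (hf s).deriv
  have hloc : IsLocalMax f x := Eventually.of_forall hmax
  have hmin : IsLocalMin f x := isLocalMin_of_deriv_deriv_pos (by rw [hd, hf'.deriv]; exact hpos)
    (by rw [hd]; exact hloc.hasDerivAt_eq_zero (hf x)) (hf x).continuousAt
  have hconst : f =ᶠ[𝓝 x] fun _ => f x := hmin.mono fun s hs => le_antisymm (hmax s) hs
  have hz : f' =ᶠ[𝓝 x] fun _ => 0 := by
    have := hconst.deriv
    rwa [hd, deriv_const'] at this
  have := (hf'.congr_of_eventuallyEq hz.symm).unique (hasDerivAt_const x (0 : ℝ))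
  linarith

/-- The left side is half the second derivative of `‖u‖²` along the flow through the maximum `p`.
The inner product is the real one of `ℂ = ℝ²`. -/
theorem inner_vf_vf_le {u : Smooth} {p : Fin 3 → ℝ} (hp : ∀ q, ‖u.1 q‖ ≤ ‖u.1 p‖)
    (v : Fin 3 → ℝ) :
    inner ℝ (u.1 p) ((vf v (vf v u)).1 p) + ‖(vf v u).1 p‖ ^ 2 ≤ 0 := by
  have h1 : ∀ s, HasDerivAt (fun s => ‖u.1 (flow v p s)‖ ^ 2)
      (2 * inner ℝ (u.1 (flow v p s)) ((vf v u).1 (flow v p s))) s := fun s =>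
    (hasDerivAt_comp_flow v u p s).norm_sq
  have h2 := ((hasDerivAt_comp_flow v u p 0).inner ℝ
    (hasDerivAt_comp_flow v (vf v u) p 0)).const_mul (2 : ℝ)
  have h3 := deriv_deriv_nonpos_of_isMax h1 h2 (fun s => by
    rw [flow_zero]; exact pow_le_pow_left₀ (norm_nonneg _) (hp _) 2)
  rw [flow_zero, real_inner_self_eq_norm_sq] at h3
  linarith

/-- A smooth eigenfunction on `Γ \ H` satisfies a pointwise gradient bound at a maximum. -/
theorem exists_gradient_bound (α h : ℝ) {ev : ℝ} {u : Smooth} (hu : u ∈ invariants)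
    (hev : lap α h u = (ev : ℂ) • u) (hu0 : u ≠ 0) :
    ∃ p, u.1 p ≠ 0 ∧ min 1 (h ^ 2) * (‖(pd 0 u).1 p‖ ^ 2
      + ‖(vf ![0, 1, 0] u).1 p‖ ^ 2 + ‖(pd 2 u).1 p‖ ^ 2) ≤ ev * ‖u.1 p‖ ^ 2 := by
  obtain ⟨p, hp⟩ := exists_norm_max hu
  have hup : u.1 p ≠ 0 := by
    intro h0
    refine hu0 (Subtype.ext (funext fun q => ?_))
    have := hp q
    rw [h0, norm_zero] at this
    exact norm_le_zero_iff.1 this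
  refine ⟨p, hup, ?_⟩
  have hpd2 : vf ![0, 0, 1] = pd 2 := by
    ext u q; simp [vf_apply]
  have i1 := inner_vf_vf_le hp ![1, α, 0]
  have i2 := inner_vf_vf_le hp ![-α, 1, 0]
  have i3 := inner_vf_vf_le hp ![0, 0, 1]
  rw [hpd2] at i3
  have hc : 0 < 1 + α ^ 2 := by positivity
  have e : inner ℝ (u.1 p) ((lap α h u).1 p) = ev * ‖u.1 p‖ ^ 2 := by
    rw [hev, ← real_inner_self_eq_norm_sq, ← inner_smul_right]
    congr 1
  have e' : (lap α h u).1 p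
      = -(((1 + α ^ 2)⁻¹ : ℝ) • (vf ![1, α, 0] (vf ![1, α, 0] u)).1 p
        + (h ^ 2 / (1 + α ^ 2) : ℝ) • (vf ![-α, 1, 0] (vf ![-α, 1, 0] u)).1 p
        + (h ^ 2 : ℝ) • (pd 2 (pd 2 u)).1 p) := by
    simp [lap]
  rw [e', inner_neg_right, inner_add_right, inner_add_right, inner_smul_right, inner_smul_right,
    inner_smul_right] at e
  have hV : (vf ![1, α, 0] u).1 p = (pd 0 u).1 p + α * (vf ![0, 1, 0] u).1 p := by
    simp [vf_apply]
  have hW : (vf ![-α, 1, 0] u).1 p = -(α * (pd 0 u).1 p) + (vf ![0, 1, 0] u).1 p := by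
    simp [vf_apply]
  -- The pair `(V, W)` is `√(1 + α²)` times a rotation of `(∂_x, ∂_y + x ∂_z)`.
  have hsum : ‖(vf ![1, α, 0] u).1 p‖ ^ 2 + ‖(vf ![-α, 1, 0] u).1 p‖ ^ 2
      = (1 + α ^ 2) * (‖(pd 0 u).1 p‖ ^ 2 + ‖(vf ![0, 1, 0] u).1 p‖ ^ 2) := by
    rw [hV, hW]
    simp only [Complex.sq_norm, Complex.normSq_apply]
    simp
    ring
  set A := ‖(vf ![1, α, 0] u).1 p‖ ^ 2
  set B := ‖(vf ![-α, 1, 0] u).1 p‖ ^ 2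
  set C := ‖(pd 2 u).1 p‖ ^ 2
  have hA : 0 ≤ A := by positivity
  have hB : 0 ≤ B := by positivity
  have hC : 0 ≤ C := by positivity
  set m := min 1 (h ^ 2)
  have hm1 : m ≤ 1 := min_le_left _ _
  have hm2 : m ≤ h ^ 2 := min_le_right _ _
  have k1 := mul_le_mul_of_nonneg_left i1 (inv_nonneg.2 hc.le)
  have k2 := mul_le_mul_of_nonneg_left i2 (div_nonneg (sq_nonneg h) hc.le)
  have k3 := mul_le_mul_of_nonneg_left i3 (sq_nonneg h)
  have hS : ‖(pd 0 u).1 p‖ ^ 2 + ‖(vf ![0, 1, 0] u).1 p‖ ^ 2 = (1 + α ^ 2)⁻¹ * (A + B) := by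
    rw [hsum]; field_simp
  rw [hS, ← e]
  have j1 : m * ((1 + α ^ 2)⁻¹ * A) ≤ 1 * ((1 + α ^ 2)⁻¹ * A) :=
    mul_le_mul_of_nonneg_right hm1 (by positivity)
  have j2 : m * ((1 + α ^ 2)⁻¹ * B) ≤ h ^ 2 * ((1 + α ^ 2)⁻¹ * B) :=
    mul_le_mul_of_nonneg_right hm2 (by positivity)
  have j3 : m * C ≤ h ^ 2 * C := mul_le_mul_of_nonneg_right hm2 hC
  rw [div_eq_mul_inv] at k2 ⊢
  nlinarith

/-! ### Reduction of the eigenspaces to smooth functions on `ℝ³` -/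

/-- The lifts to `ℝ³` of the smooth solutions of `Δ_h f = ev f` on `Γ \ H`. -/
def liftedEigenspace (α h ev : ℝ) : Submodule ℂ Smooth :=
  invariants ⊓ Module.End.eigenspace (lap α h) (ev : ℂ)

theorem covering_surjective : Function.Surjective covering := by
  intro q
  obtain ⟨⟨_, p, rfl⟩, rfl⟩ := Quotient.exists_rep q
  exact ⟨p, rfl⟩

theorem gamma_mul (p q : Fin 3 → ℝ) : gamma p * gamma q = gamma (leftTrans p q) :=
  Subtype.ext (heisGL_mul p q)

theorem gamma_injective : Function.Injective gamma := by
  intro p q h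
  have h' : heisMatrix p = heisMatrix q := congrArg (fun g : heisenbergGroup => (g : GL (Fin 3) ℝ).val) h
  have h0 := congrFun (congrFun h' 0) 1
  have h1 := congrFun (congrFun h' 1) 2
  have h2 := congrFun (congrFun h' 0) 2
  ext i
  fin_cases i
  · simpa [heisMatrix] using h0
  · simpa [heisMatrix] using h1
  · simpa [heisMatrix] using h2

theorem covering_eq_iff (p q : Fin 3 → ℝ) :
    covering p = covering q ↔ ∃ a b c : ℤ, q = leftTrans ![a, b, c] p := by
  rw [covering, covering, Quotient.eq, QuotientGroup.rightRel_apply]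
  constructor
  · rintro ⟨a, b, c, h⟩
    refine ⟨a, b, c, gamma_injective ?_⟩
    rw [← gamma_mul, ← h, inv_mul_cancel_right]
  · rintro ⟨a, b, c, rfl⟩
    refine ⟨a, b, c, ?_⟩
    rw [← gamma_mul, mul_inv_cancel_right]

/-- The lift of functions on `Γ \ H` to `ℝ³`. -/
def lift : (Nilmanifold → ℂ) →ₗ[ℂ] ((Fin 3 → ℝ) → ℂ) := LinearMap.funLeft ℂ ℂ covering

theorem isEigenfunction_iff (α : ℝ) {h : ℝ} (hh : h ≠ 0) (ev : ℝ) (f : Nilmanifold → ℂ) :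
    IsEigenfunction α h ev f ↔
      lift f ∈ (liftedEigenspace α h ev).map smoothFunctions.subtype := by
  constructor
  · rintro ⟨hs, he⟩
    refine ⟨⟨f ∘ covering, mem_smoothFunctions.2 hs⟩, ⟨?_, ?_⟩, rfl⟩
    · intro a b c p
      exact congrArg f ((covering_eq_iff p _).2 ⟨a, b, c, rfl⟩).symm
    · refine Module.End.mem_eigenspace_iff.2 (Subtype.ext (funext fun p => ?_))
      rw [← laplacian_eq_lap α hh]
      exact he p
  · rintro ⟨u, ⟨-, hu⟩, huf⟩
    have huf' : u.1 = f ∘ covering := huf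
    refine ⟨huf' ▸ Smooth.contDiff u, fun p => ?_⟩
    rw [← huf', laplacian_eq_lap α hh, Module.End.mem_eigenspace_iff.1 hu]
    change (ev : ℂ) * u.1 p = _
    rw [huf']; rfl

/-- Lifting is injective because the covering is onto, and every invariant smooth solution on `ℝ³`
descends to the quotient. -/
theorem rank_eigenspace (α : ℝ) {h : ℝ} (hh : h ≠ 0) (ev : ℝ) :
    Module.rank ℂ (eigenspace α h ev) = Module.rank ℂ (liftedEigenspace α h ev) := by
  set N := (liftedEigenspace α h ev).map smoothFunctions.subtype with hN
  have hinj : Function.Injective lift := LinearMap.funLeft_injective_of_surjective _ _ _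
    covering_surjective
  have h1 : eigenspace α h ev = N.comap lift := by
    have : {f | IsEigenfunction α h ev f} = (N.comap lift : Set (Nilmanifold → ℂ)) := by
      ext f; exact isEigenfunction_iff α hh ev f
    rw [eigenspace, this, Submodule.span_eq]
  have h2 : (N.comap lift).map lift = N := by
    refine Submodule.map_comap_eq_self ?_
    rintro _ ⟨u, ⟨hu, -⟩, rfl⟩
    -- The descended function is read off on a set-theoretic section; invariance makes the choice
    -- irrelevant.
    refine ⟨fun q => u.1 (Function.surjInv covering_surjective q), funext fun p => ?_⟩
    obtain ⟨a, b, c, h⟩ := (covering_eq_iff p _).1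
      (Function.surjInv_eq covering_surjective (covering p)).symm
    change u.1 (Function.surjInv covering_surjective (covering p)) = u.1 p
    rw [h]
    exact hu a b c p
  rw [h1, (Submodule.equivMapOfInjective lift hinj _).rank_eq, h2,
    ← (Submodule.equivMapOfInjective smoothFunctions.subtype
      (Submodule.subtype_injective _) (liftedEigenspace α h ev)).rank_eq]

/-! ### Dimensions -/

/-- The dimension of a complex vector space as an extended nonnegative real. -/
def dim (V : Type) [AddCommGroup V] [Module ℂ V] : ℝ≥0∞ :=
  ((Cardinal.toENat (Module.rank ℂ V) : ℕ∞) : ℝ≥0∞)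

theorem toENat_sum {ι : Type} [Fintype ι] (f : ι → Cardinal.{0}) :
    Cardinal.toENat (Cardinal.sum f) = ∑ i, Cardinal.toENat (f i) := by
  by_cases h : ∀ i, f i < Cardinal.aleph0
  · choose n hn using fun i => Cardinal.lt_aleph0.1 (h i)
    have h1 : Cardinal.sum f = ((∑ i, n i : ℕ) : Cardinal) := by
      rw [funext hn]
      have := Cardinal.mk_sigma fun i => Fin (n i)
      simp only [Cardinal.mk_fin] at this
      rw [← this, Cardinal.mk_fintype, Fintype.card_sigma]
      simp
    rw [h1]
    simp [hn]
  · push Not at h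
    obtain ⟨i, hi⟩ := h
    rw [Cardinal.toENat_eq_top.2 (hi.trans (Cardinal.le_sum f i))]
    exact (WithTop.sum_eq_top.2 ⟨i, Finset.mem_univ _, Cardinal.toENat_eq_top.2 hi⟩).symm

theorem dim_pi {ι : Type} [Fintype ι] (V : ι → Type) [∀ i, AddCommGroup (V i)]
    [∀ i, Module ℂ (V i)] : dim (∀ i, V i) = ∑ i, dim (V i) := by
  simp only [dim]
  rw [rank_pi, toENat_sum]
  exact map_sum ENat.toENNRealRingHom _ _

theorem dim_congr {V W : Type} [AddCommGroup V] [Module ℂ V] [AddCommGroup W] [Module ℂ W]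
    (e : V ≃ₗ[ℂ] W) : dim V = dim W := by
  rw [dim, dim, e.rank_eq]

theorem dim_le_of_injOn {V : Type} [AddCommGroup V] [Module ℂ V] {N N' : Submodule ℂ V}
    (T : Module.End ℂ V) (hT : ∀ u ∈ N, T u ∈ N') (hinj : ∀ u ∈ N, T u = 0 → u = 0) :
    dim N ≤ dim N' := by
  refine ENat.toENNReal_le.2 (Cardinal.toENat.monotone' ?_)
  refine LinearMap.rank_le_of_injective (T.restrict hT) ?_
  rw [injective_iff_map_eq_zero]
  intro u hu
  exact Subtype.ext (hinj u u.2 (congrArg Subtype.val hu))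

theorem dim_bot {V : Type} [AddCommGroup V] [Module ℂ V] : dim (⊥ : Submodule ℂ V) = 0 := by
  simp [dim]

/-- The decomposition of a space of periodic functions into its Fourier modes. -/
theorem dim_eq_tsum_isotypic {E : Submodule ℂ Smooth} {v : Fin 3 → ℝ} (hper : E ≤ periodic v)
    (hproj : ∀ u ∈ E, ∀ k, modeProj v k u ∈ E)
    (hfin : {k : ℤ | E ⊓ isotypic v k ≠ ⊥}.Finite) :
    dim E = ∑' k : ℤ, dim ↥(E ⊓ isotypic v k) := by
  set F := hfin.toFinset
  have hF : ∀ k ∉ F, E ⊓ isotypic v k = ⊥ := fun k hk => by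
    simpa [F, Set.Finite.mem_toFinset] using hk
  have hmem : ∀ u ∈ E, ∀ k, modeProj v k u ∈ E ⊓ isotypic v k := fun u hu k =>
    ⟨hproj u hu k, modeProj_mem_isotypic (hper hu) k⟩
  -- The map to the finitely many modes that can be nonzero: injective since the modes determine a
  -- periodic function, surjective since the mode projections are orthogonal idempotents on sums of
  -- modes.
  let T : E →ₗ[ℂ] (∀ k : F, ↥(E ⊓ isotypic v k)) :=
    LinearMap.pi fun k => ((modeProj v k).comp E.subtype).codRestrict _
      (fun u => hmem u u.2 k)
  have hTval : ∀ (u : E) (k : F), ((T u k : ↥(E ⊓ isotypic v k)) : Smooth) = modeProj v k u :=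
    fun _ _ => rfl
  have hinj : Function.Injective T := by
    rw [injective_iff_map_eq_zero]
    intro u hu
    refine Subtype.ext (eq_zero_of_modeProj_eq_zero (hper u.2) fun k => ?_)
    by_cases hk : k ∈ F
    · rw [← hTval u ⟨k, hk⟩, hu]; rfl
    · have := hmem u u.2 k
      rw [hF k hk] at this
      exact (Submodule.mem_bot ℂ).1 this
  have hsurj : Function.Surjective T := by
    intro g
    refine ⟨⟨∑ k : F, (g k : Smooth), E.sum_mem fun k _ => (g k).2.1⟩, funext fun j => ?_⟩
    refine Subtype.ext ?_
    rw [hTval, map_sum, Finset.sum_eq_single j]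
    · rw [modeProj_of_mem_isotypic (g j).2.2, if_pos rfl]
    · intro k _ hkj
      rw [modeProj_of_mem_isotypic (g k).2.2, if_neg fun h => hkj (Subtype.ext h.symm)]
    · simp
  rw [dim_congr (W := ∀ k : F, ↥(E ⊓ isotypic v k)) (LinearEquiv.ofBijective T ⟨hinj, hsurj⟩),
    dim_pi, tsum_eq_sum (s := F)]
  · exact Finset.sum_coe_sort F fun k => dim ↥(E ⊓ isotypic v k)
  · intro k hk
    rw [hF k hk, dim_bot]

/-! ### The ladder of a harmonic oscillator -/

section Ladder

variable {V : Type} [AddCommGroup V] [Module ℂ V]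

/-- The lowering operator `P` and the raising operator `Q` of a harmonic oscillator `L`, acting on
a subspace `U` on which `L` has no negative eigenvalue. -/
structure IsLadder (U : Submodule ℂ V) (L P Q : Module.End ℂ V) (a δ : ℝ) : Prop where
  pos : 0 < δ
  mapsP : ∀ u ∈ U, P u ∈ U
  mapsQ : ∀ u ∈ U, Q u ∈ U
  QP : ∀ u ∈ U, Q (P u) = (a : ℂ) • u - L u
  PQ : ∀ u ∈ U, P (Q u) = ((a - 2 * δ : ℝ) : ℂ) • u - L u
  nonneg : ∀ ev : ℝ, ev < 0 → U ⊓ Module.End.eigenspace L (ev : ℂ) = ⊥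

variable {U : Submodule ℂ V} {L P Q : Module.End ℂ V} {a δ : ℝ}

theorem IsLadder.mapsP_eigenspace (H : IsLadder U L P Q a δ) (ev : ℝ) {u : V}
    (hu : u ∈ U ⊓ Module.End.eigenspace L (ev : ℂ)) :
    P u ∈ U ⊓ Module.End.eigenspace L ((ev - 2 * δ : ℝ) : ℂ) := by
  refine ⟨H.mapsP u hu.1, Module.End.mem_eigenspace_iff.2 ?_⟩
  have h1 := H.PQ (P u) (H.mapsP u hu.1)
  rw [H.QP u hu.1, Module.End.mem_eigenspace_iff.1 hu.2, map_sub, map_smul, map_smul] at h1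
  have h2 : L (P u) = ((a - 2 * δ : ℝ) : ℂ) • P u - ((a : ℂ) • P u - (ev : ℂ) • P u) := by
    rw [h1]; abel
  rw [h2]
  push_cast
  module

theorem IsLadder.mapsQ_eigenspace (H : IsLadder U L P Q a δ) (ev : ℝ) {u : V}
    (hu : u ∈ U ⊓ Module.End.eigenspace L ((ev - 2 * δ : ℝ) : ℂ)) :
    Q u ∈ U ⊓ Module.End.eigenspace L (ev : ℂ) := by
  refine ⟨H.mapsQ u hu.1, Module.End.mem_eigenspace_iff.2 ?_⟩
  have h1 := H.QP (Q u) (H.mapsQ u hu.1)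
  rw [H.PQ u hu.1, Module.End.mem_eigenspace_iff.1 hu.2, map_sub, map_smul, map_smul] at h1
  have h2 : L (Q u) = (a : ℂ) • Q u
      - (((a - 2 * δ : ℝ) : ℂ) • Q u - ((ev - 2 * δ : ℝ) : ℂ) • Q u) := by
    rw [h1]; abel
  rw [h2]
  push_cast
  module

/-- On these two eigenspaces `QP` and `PQ` are both the scalar `a - ev ≠ 0`, so `P` and `Q` are
injective. Two inequalities are used, which need no finiteness of the dimensions. -/
theorem IsLadder.dim_step (H : IsLadder U L P Q a δ) {ev : ℝ} (hev : ev ≠ a) :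
    dim ↥(U ⊓ Module.End.eigenspace L (ev : ℂ))
      = dim ↥(U ⊓ Module.End.eigenspace L ((ev - 2 * δ : ℝ) : ℂ)) := by
  have hne : (a : ℂ) - ev ≠ 0 := by
    rw [sub_ne_zero]; exact_mod_cast hev.symm
  refine le_antisymm (dim_le_of_injOn P (fun u hu => H.mapsP_eigenspace ev hu) ?_)
    (dim_le_of_injOn Q (fun u hu => H.mapsQ_eigenspace ev hu) ?_)
  · intro u hu h0
    have := H.QP u hu.1
    rw [h0, map_zero, Module.End.mem_eigenspace_iff.1 hu.2, ← sub_smul] at this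
    exact (smul_eq_zero.1 this.symm).resolve_left hne
  · intro u hu h0
    have := H.PQ u hu.1
    rw [h0, map_zero, Module.End.mem_eigenspace_iff.1 hu.2, ← sub_smul] at this
    refine (smul_eq_zero.1 this.symm).resolve_left ?_
    push_cast
    rwa [sub_sub_sub_cancel_right]

/-- Steps of `-2δ` preserve the dimension as long as they avoid `a`, and after at most `m` of them
the eigenvalue is negative. -/
theorem IsLadder.dim_eq_zero (H : IsLadder U L P Q a δ) (m : ℕ) : ∀ ev : ℝ, ev < 2 * δ * m →
    (∀ j : ℕ, a + 2 * δ * j ≠ ev) → dim ↥(U ⊓ Module.End.eigenspace L (ev : ℂ)) = 0 := by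
  induction m with
  | zero =>
    intro ev hev _
    rw [H.nonneg ev (by simpa using hev), dim_bot]
  | succ m ih =>
    intro ev hev hj
    rw [H.dim_step (fun h => hj 0 (by simp [h]))]
    refine ih _ (by push_cast at hev; linarith) fun j h => hj (j + 1) ?_
    push_cast; linarith

theorem IsLadder.eq_bot (H : IsLadder U L P Q a δ) {ev : ℝ}
    (hj : ∀ j : ℕ, a + 2 * δ * j ≠ ev) : U ⊓ Module.End.eigenspace L (ev : ℂ) = ⊥ := by
  obtain ⟨m, hm⟩ := exists_nat_gt (ev / (2 * δ))
  have hpos := H.pos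
  have h := H.dim_eq_zero m ev (by rw [div_lt_iff₀ (by positivity)] at hm; linarith) hj
  simp only [dim, ENat.toENNReal_eq_zero, Cardinal.toENat_eq_zero] at h
  exact Submodule.rank_eq_zero.1 h

/-- `P` sends the eigenspace of `a` into that of `a - 2δ`, which is below the ladder and hence zero;
conversely `P u = 0` gives `L u = a u` through `QP = a - L`. -/
theorem IsLadder.eigenspace_bottom (H : IsLadder U L P Q a δ) :
    U ⊓ Module.End.eigenspace L (a : ℂ) = U ⊓ LinearMap.ker P := by
  have hpos := H.pos
  ext u
  constructor
  · intro hu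
    refine ⟨hu.1, ?_⟩
    have h := H.mapsP_eigenspace a hu
    rw [H.eq_bot (fun j h => by
      have : (0 : ℝ) ≤ 2 * δ * j := by positivity
      linarith)] at h
    exact (Submodule.mem_bot ℂ).1 h
  · intro hu
    refine ⟨hu.1, Module.End.mem_eigenspace_iff.2 ?_⟩
    have := H.QP u hu.1
    rw [LinearMap.mem_ker.1 hu.2, map_zero] at this
    exact (sub_eq_zero.1 this.symm).symm

theorem IsLadder.dim_level (H : IsLadder U L P Q a δ) (j : ℕ) :
    dim ↥(U ⊓ Module.End.eigenspace L ((a + 2 * δ * j : ℝ) : ℂ))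
      = dim ↥(U ⊓ LinearMap.ker P) := by
  have hpos := H.pos
  induction j with
  | zero => rw [show a + 2 * δ * ((0 : ℕ) : ℝ) = a by simp, H.eigenspace_bottom]
  | succ j ih =>
    rw [H.dim_step, ← ih]
    · have : a + 2 * δ * ((j + 1 : ℕ) : ℝ) - 2 * δ = a + 2 * δ * j := by push_cast; ring
      rw [this]
    · have : (0 : ℝ) < 2 * δ * ((j + 1 : ℕ) : ℝ) := by positivity
      linarith

theorem IsLadder.dim_eigenspace (H : IsLadder U L P Q a δ) (ev : ℝ) :
    dim ↥(U ⊓ Module.End.eigenspace L (ev : ℂ))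
      = ∑' j : ℕ, if a + 2 * δ * j = ev then dim ↥(U ⊓ LinearMap.ker P) else 0 := by
  have hpos := H.pos
  by_cases h : ∃ j : ℕ, a + 2 * δ * j = ev
  · obtain ⟨j, rfl⟩ := h
    rw [H.dim_level j, tsum_eq_single j, if_pos rfl]
    intro i hi
    rw [if_neg]
    intro h
    apply hi
    have : (i : ℝ) = j := by
      have : 2 * δ * (i : ℝ) = 2 * δ * j := by linarith
      exact mul_left_cancel₀ (by positivity) this
    exact_mod_cast this
  · push Not at h
    rw [H.eq_bot h, dim_bot]
    simp [h]

end Ladder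

/-! ### Invariance properties of the Fourier modes -/

theorem modeProj_mem_isotypic_of_mem {v w : Fin 3 → ℝ} {k m : ℤ} {u : Smooth}
    (hu : u ∈ isotypic w m) : modeProj v k u ∈ isotypic w m := by
  intro p t
  rw [modeProj_apply, modeProj_apply, ← intervalIntegral.integral_const_mul]
  refine intervalIntegral.integral_congr fun s _ => ?_
  rw [add_right_comm, hu]
  ring

theorem modeProj_comm_lap {v : Fin 3 → ℝ} (hv : v 0 = 0) (k : ℤ) (α h : ℝ) (u : Smooth) :
    modeProj v k (lap α h u) = lap α h (modeProj v k u) := by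
  have c : ∀ w u, modeProj v k (vf w u) = vf w (modeProj v k u) := fun w u =>
    congrArg (fun T : Module.End ℂ Smooth => T u) (modeProj_comm_vf hv k w)
  have c2 : ∀ u, modeProj v k (pd 2 u) = pd 2 (modeProj v k u) := fun u =>
    congrArg (fun T : Module.End ℂ Smooth => T u) (modeProj_comm_pd v k 2)
  simp [lap, c, c2]

theorem modeProj_e2_mem_lifted {α h ev : ℝ} {u : Smooth} (hu : u ∈ liftedEigenspace α h ev)
    (k : ℤ) : modeProj (Pi.single 2 1) k u ∈ liftedEigenspace α h ev := by
  refine ⟨fun a b c p => ?_, ?_⟩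
  · rw [modeProj_apply, modeProj_apply]
    refine intervalIntegral.integral_congr fun s _ => ?_
    have : leftTrans ![(a : ℝ), b, c] p + s • Pi.single 2 1
        = leftTrans ![(a : ℝ), b, c] (p + s • Pi.single 2 1) := by
      ext i; fin_cases i <;> simp [leftTrans]; ring
    simp only [this, hu.1 a b c]
  · refine Module.End.mem_eigenspace_iff.2 ?_
    rw [← modeProj_comm_lap (by simp),
      Module.End.mem_eigenspace_iff.1 hu.2, map_smul]

theorem invariants_le_periodic_e2 : invariants ≤ periodic (Pi.single 2 1) := by
  intro u hu p
  have e : leftTrans ![((0 : ℤ) : ℝ), ((0 : ℤ) : ℝ), ((1 : ℤ) : ℝ)] p = p + Pi.single 2 1 := by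
    ext i; fin_cases i <;> simp [leftTrans, add_comm]
  rw [← e, hu 0 0 1 p]

theorem invariants_le_periodic_e1 : invariants ≤ periodic (Pi.single 1 1) := by
  intro u hu p
  have e : leftTrans ![((0 : ℤ) : ℝ), ((1 : ℤ) : ℝ), ((0 : ℤ) : ℝ)] p = p + Pi.single 1 1 := by
    ext i; fin_cases i <;> simp [leftTrans, add_comm]
  rw [← e, hu 0 1 0 p]

theorem finite_int_sq_le {c : ℝ} (hc : 0 < c) (B : ℝ) : {k : ℤ | c * (k : ℝ) ^ 2 ≤ B}.Finite := by
  refine (Set.finite_Icc (-⌈B / c⌉) ⌈B / c⌉).subset fun k hk => ?_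
  have h1 : (k : ℝ) ^ 2 ≤ B / c := by rw [le_div_iff₀ hc]; linarith [hk.out]
  have h2 : ((k ^ 2 : ℤ) : ℝ) ≤ (⌈B / c⌉ : ℤ) := by push_cast; exact h1.trans (Int.le_ceil _)
  have h3 : k ^ 2 ≤ ⌈B / c⌉ := by exact_mod_cast h2
  constructor <;> nlinarith [Int.le_self_sq k, Int.le_self_sq (-k)]

theorem norm_two_pi_I_smul_sq (k : ℤ) (z : ℂ) :
    ‖(2 * Real.pi * Complex.I * k : ℂ) * z‖ ^ 2 = 4 * Real.pi ^ 2 * (k : ℝ) ^ 2 * ‖z‖ ^ 2 := by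
  simp [mul_pow]
  norm_num

theorem lap_nonneg (α h : ℝ) {ev : ℝ} (hev : ev < 0) : liftedEigenspace α h ev = ⊥ := by
  rw [Submodule.eq_bot_iff]
  intro u hu
  by_contra hu0
  obtain ⟨p, hp, hle⟩ := exists_gradient_bound α h hu.1 (Module.End.mem_eigenspace_iff.1 hu.2) hu0
  have h1 : 0 < ‖u.1 p‖ ^ 2 := by positivity
  have h2 : 0 ≤ min 1 (h ^ 2) := le_min zero_le_one (sq_nonneg h)
  have h3 : 0 ≤ min 1 (h ^ 2) * (‖(pd 0 u).1 p‖ ^ 2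
      + ‖(vf ![0, 1, 0] u).1 p‖ ^ 2 + ‖(pd 2 u).1 p‖ ^ 2) := mul_nonneg h2 (by positivity)
  nlinarith

/-- Only finitely many modes occur: on mode `k`, `|∂_z u| = 2π|k||u|`, so the gradient bound at a
maximum gives `min(1, h²) 4π² k² ≤ ev`. -/
theorem dim_lifted_eq_tsum (α : ℝ) {h : ℝ} (hh : h ≠ 0) (ev : ℝ) :
    dim (liftedEigenspace α h ev)
      = ∑' n : ℤ, dim ↥(liftedEigenspace α h ev ⊓ isotypic (Pi.single 2 1) n) := by
  have hm : 0 < min 1 (h ^ 2) := lt_min one_pos (by positivity)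
  refine dim_eq_tsum_isotypic (fun u hu => invariants_le_periodic_e2 hu.1)
    (fun u hu k => modeProj_e2_mem_lifted hu k) ?_
  refine (finite_int_sq_le (c := min 1 (h ^ 2) * (4 * Real.pi ^ 2)) (by positivity) ev).subset ?_
  intro k hk
  obtain ⟨u, hu, hu0⟩ := (Submodule.ne_bot_iff _).1 hk
  obtain ⟨p, hp, hle⟩ := exists_gradient_bound α h hu.1.1
    (Module.End.mem_eigenspace_iff.1 hu.1.2) hu0
  have hpd := congrArg (fun w : Smooth => w.1 p) (pd_of_mem_isotypic hu.2)
  change (pd 2 u).1 p = (2 * Real.pi * Complex.I * k : ℂ) * u.1 p at hpd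
  rw [hpd, norm_two_pi_I_smul_sq] at hle
  have h1 : 0 < ‖u.1 p‖ ^ 2 := by positivity
  have h2 : min 1 (h ^ 2) * (4 * Real.pi ^ 2 * (k : ℝ) ^ 2 * ‖u.1 p‖ ^ 2) ≤ ev * ‖u.1 p‖ ^ 2 := by
    refine le_trans (mul_le_mul_of_nonneg_left ?_ hm.le) hle
    exact le_add_of_nonneg_left (by positivity)
  refine le_of_mul_le_mul_right ?_ h1
  linarith

/-! ### Functions that do not depend on `z` -/

/-- The eigenvalue of `Δ_h` on the function `exp(2πi (kx + ly))`. -/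
def torusEigenvalue (α h : ℝ) (l k : ℤ) : ℝ :=
  4 * Real.pi ^ 2 * ((1 + α ^ 2)⁻¹ * (k + α * l) ^ 2 + h ^ 2 / (1 + α ^ 2) * (l - α * k) ^ 2)

theorem isotypic_zero_apply {u : Smooth} (hu : u ∈ isotypic (Pi.single 2 1) 0) (p : Fin 3 → ℝ)
    (s : ℝ) : u.1 (p + s • Pi.single 2 1) = u.1 p := by
  simpa [ex_zero] using hu p s

theorem pd_two_of_mem {u : Smooth} (hu : u ∈ isotypic (Pi.single 2 1) 0) : pd 2 u = 0 := by
  rw [pd_of_mem_isotypic hu]; simp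

theorem pd_comm_apply (i j : Fin 3) (u : Smooth) : pd i (pd j u) = pd j (pd i u) :=
  congrArg (fun T : Module.End ℂ Smooth => T u) (pd_comm i j)

theorem vf_of_pd_two {v : Fin 3 → ℝ} {u : Smooth} (hu : pd 2 u = 0) :
    vf v u = (v 0 : ℂ) • pd 0 u + (v 1 : ℂ) • pd 1 u := by
  simp [vf, hu, -Complex.coe_smul]

/-- Without dependence on `z` the operator has constant coefficients. This makes the Fourier
decomposition in `x` available, although translations in `x` do not commute with `lap` in general.
-/
theorem lap_of_pd_two {α h : ℝ} {u : Smooth} (hu : pd 2 u = 0) :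
    lap α h u = -(((1 + (α : ℂ) ^ 2)⁻¹ : ℂ) • (pd 0 (pd 0 u + (α : ℂ) • pd 1 u)
        + (α : ℂ) • pd 1 (pd 0 u + (α : ℂ) • pd 1 u))
      + (h ^ 2 / (1 + α ^ 2) : ℂ) • (-(α : ℂ) • pd 0 (-(α : ℂ) • pd 0 u + pd 1 u)
        + pd 1 (-(α : ℂ) • pd 0 u + pd 1 u))) := by
  have h1 : vf ![1, α, 0] u = pd 0 u + (α : ℂ) • pd 1 u := by
    rw [vf_of_pd_two hu]; simp
  have h2 : vf ![-α, 1, 0] u = -(α : ℂ) • pd 0 u + pd 1 u := by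
    rw [vf_of_pd_two hu]; simp
  have k1 : pd 2 (pd 0 u + (α : ℂ) • pd 1 u) = 0 := by
    rw [map_add, map_smul, pd_comm_apply 2 0, pd_comm_apply 2 1, hu]; simp
  have k2 : pd 2 (-(α : ℂ) • pd 0 u + pd 1 u) = 0 := by
    rw [map_add, map_smul, pd_comm_apply 2 0, pd_comm_apply 2 1, hu]; simp
  have h3 : vf ![1, α, 0] (pd 0 u + (α : ℂ) • pd 1 u)
      = pd 0 (pd 0 u + (α : ℂ) • pd 1 u) + (α : ℂ) • pd 1 (pd 0 u + (α : ℂ) • pd 1 u) := by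
    rw [vf_of_pd_two k1]; simp
  have h4 : vf ![-α, 1, 0] (-(α : ℂ) • pd 0 u + pd 1 u)
      = -(α : ℂ) • pd 0 (-(α : ℂ) • pd 0 u + pd 1 u) + pd 1 (-(α : ℂ) • pd 0 u + pd 1 u) := by
    rw [vf_of_pd_two k2]; simp
  have : lap α h u = -(((1 + (α : ℂ) ^ 2)⁻¹ : ℂ) • vf ![1, α, 0] (vf ![1, α, 0] u)
    + (h ^ 2 / (1 + α ^ 2) : ℂ) • vf ![-α, 1, 0] (vf ![-α, 1, 0] u)
    + (h ^ 2 : ℂ) • pd 2 (pd 2 u)) := rfl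
  rw [this, hu, h1, h2, h3, h4, map_zero, smul_zero, add_zero]

theorem lap_character {α h : ℝ} {l k : ℤ} {u : Smooth} (h0 : u ∈ isotypic (Pi.single 0 1) k)
    (h1 : u ∈ isotypic (Pi.single 1 1) l) (h2 : u ∈ isotypic (Pi.single 2 1) 0) :
    lap α h u = (torusEigenvalue α h l k : ℂ) • u := by
  rw [lap_of_pd_two (pd_two_of_mem h2)]
  simp only [map_smul, pd_of_mem_isotypic h0, pd_of_mem_isotypic h1, smul_smul,
    ← add_smul, ← neg_smul]
  congr 1
  have hI : Complex.I ^ 2 = -1 := Complex.I_sq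
  simp only [torusEigenvalue]
  push_cast
  ring_nf
  simp only [hI]
  ring

theorem modeProj_e1_mem {α h ev : ℝ} {u : Smooth}
    (hu : u ∈ liftedEigenspace α h ev ⊓ isotypic (Pi.single 2 1) 0) (k : ℤ) :
    modeProj (Pi.single 1 1) k u ∈ liftedEigenspace α h ev ⊓ isotypic (Pi.single 2 1) 0 := by
  refine ⟨⟨fun a b c p => ?_, ?_⟩, modeProj_mem_isotypic_of_mem hu.2⟩
  · rw [modeProj_apply, modeProj_apply]
    refine intervalIntegral.integral_congr fun s _ => ?_
    -- The two translations commute up to a shift in `z`, invisible on the mode `n = 0`.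
    have : leftTrans ![(a : ℝ), b, c] p + s • Pi.single 1 1
        = leftTrans ![(a : ℝ), b, c] (p + s • Pi.single 1 1) + (-(a * s)) • Pi.single 2 1 := by
      ext i; fin_cases i <;> simp [leftTrans] <;> ring
    simp only [this, isotypic_zero_apply hu.2, hu.1.1 a b c]
  · refine Module.End.mem_eigenspace_iff.2 ?_
    rw [← modeProj_comm_lap (by simp),
      Module.End.mem_eigenspace_iff.1 hu.1.2, map_smul]

theorem modeProj_e0_mem {α h ev : ℝ} {l : ℤ} {u : Smooth}
    (hu : u ∈ liftedEigenspace α h ev ⊓ isotypic (Pi.single 2 1) 0 ⊓ isotypic (Pi.single 1 1) l)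
    (k : ℤ) : modeProj (Pi.single 0 1) k u
      ∈ liftedEigenspace α h ev ⊓ isotypic (Pi.single 2 1) 0 ⊓ isotypic (Pi.single 1 1) l := by
  have hz : modeProj (Pi.single 0 1) k u ∈ isotypic (Pi.single 2 1) 0 :=
    modeProj_mem_isotypic_of_mem hu.1.2
  refine ⟨⟨⟨fun a b c p => ?_, ?_⟩, hz⟩, modeProj_mem_isotypic_of_mem hu.2⟩
  · rw [modeProj_apply, modeProj_apply]
    refine intervalIntegral.integral_congr fun s _ => ?_
    have : leftTrans ![(a : ℝ), b, c] p + s • Pi.single 0 1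
        = leftTrans ![(a : ℝ), b, c] (p + s • Pi.single 0 1) := by
      ext i; fin_cases i <;> simp [leftTrans]; ring
    simp only [this, hu.1.1.1 a b c]
  · have c : ∀ i w, modeProj (Pi.single 0 1) k (pd i w) = pd i (modeProj (Pi.single 0 1) k w) :=
      fun i w => congrArg (fun T : Module.End ℂ Smooth => T w) (modeProj_comm_pd _ k i)
    have := congrArg (modeProj (Pi.single 0 1) k) (Module.End.mem_eigenspace_iff.1 hu.1.1.2)
    rw [map_smul, lap_of_pd_two (pd_two_of_mem hu.1.2)] at this
    refine Module.End.mem_eigenspace_iff.2 ?_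
    rw [← this, lap_of_pd_two (pd_two_of_mem hz)]
    simp only [map_neg, map_add, map_smul, c]

/-- The function `exp(2πi (kx + ly))`. -/
def torusCharacter (l k : ℤ) : Smooth :=
  ⟨fun p => ex (k * p 0 + l * p 1), mem_smoothFunctions.2 (contDiff_ex.comp (by
    have h : ∀ i : Fin 3, ContDiff ℝ ∞ fun p : Fin 3 → ℝ => (p i : ℂ) := fun i =>
      Complex.ofRealCLM.contDiff.comp (contDiff_apply ℝ ℝ i)
    exact (contDiff_const.mul (h 0)).add (contDiff_const.mul (h 1))))⟩

theorem torusCharacter_apply (l k : ℤ) (p : Fin 3 → ℝ) :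
    (torusCharacter l k).1 p = ex (k * p 0 + l * p 1) := rfl

theorem dim_torus_character (α h ev : ℝ) (l k : ℤ) :
    dim ↥(liftedEigenspace α h ev ⊓ isotypic (Pi.single 2 1) 0 ⊓ isotypic (Pi.single 1 1) l
      ⊓ isotypic (Pi.single 0 1) k) = if torusEigenvalue α h l k = ev then 1 else 0 := by
  split_ifs with hev
  · have hspan : liftedEigenspace α h ev ⊓ isotypic (Pi.single 2 1) 0 ⊓ isotypic (Pi.single 1 1) l
      ⊓ isotypic (Pi.single 0 1) k = Submodule.span ℂ {torusCharacter l k} := by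
      have m0 : torusCharacter l k ∈ isotypic (Pi.single 0 1) k := by
        intro p s
        rw [torusCharacter_apply, torusCharacter_apply, ← ex_add]
        congr 1; simp; ring
      have m1 : torusCharacter l k ∈ isotypic (Pi.single 1 1) l := by
        intro p s
        rw [torusCharacter_apply, torusCharacter_apply, ← ex_add]
        congr 1; simp; ring
      have m2 : torusCharacter l k ∈ isotypic (Pi.single 2 1) 0 := by
        intro p s
        rw [torusCharacter_apply, torusCharacter_apply, ← ex_add]
        congr 1; simp
      refine le_antisymm (fun u hu => ?_) ?_
      · refine Submodule.mem_span_singleton.2 ⟨u.1 0, ?_⟩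
        ext p
        have hp : p = 0 + p 0 • Pi.single 0 1 + p 1 • Pi.single 1 1 + p 2 • Pi.single 2 1 := by
          ext i; fin_cases i <;> simp
        change u.1 0 * (torusCharacter l k).1 p = u.1 p
        conv_rhs => rw [hp]
        rw [isotypic_zero_apply hu.1.1.2, hu.1.2, hu.2, torusCharacter_apply, ex_add]
        ring
      · rw [Submodule.span_singleton_le_iff_mem]
        refine ⟨⟨⟨⟨fun a b c p => ?_, ?_⟩, m2⟩, m1⟩, m0⟩
        · rw [torusCharacter_apply, torusCharacter_apply]
          have : ((k : ℂ) * ((leftTrans ![(a : ℝ), b, c] p 0 : ℝ) : ℂ)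
              + l * ((leftTrans ![(a : ℝ), b, c] p 1 : ℝ) : ℂ))
              = (k * p 0 + l * p 1) + ((k * a + l * b : ℤ) : ℂ) := by
            simp [leftTrans]; ring
          rw [this, ex_add, ex_int, mul_one]
        · refine Module.End.mem_eigenspace_iff.2 ?_
          rw [lap_character m0 m1 m2, hev]
    have hne : torusCharacter l k ≠ 0 := by
      intro h
      have := congrArg (fun w : Smooth => w.1 0) h
      exact ex_ne_zero _ this
    rw [hspan, dim, Module.rank_eq_one_iff_finrank_eq_one.2 (finrank_span_singleton hne)]
    simp
  · suffices hb : liftedEigenspace α h ev ⊓ isotypic (Pi.single 2 1) 0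
        ⊓ isotypic (Pi.single 1 1) l ⊓ isotypic (Pi.single 0 1) k = ⊥ by rw [hb, dim_bot]
    refine (Submodule.eq_bot_iff _).2 fun u hu => ?_
    have h1 := Module.End.mem_eigenspace_iff.1 hu.1.1.1.2
    rw [lap_character hu.2 hu.1.2 hu.1.1.2] at h1
    have h2 : ((torusEigenvalue α h l k : ℂ) - ev) • u = 0 :=
      (sub_smul _ _ u).trans (sub_eq_zero.2 h1)
    refine (smul_eq_zero.1 h2).resolve_left ?_
    rw [sub_eq_zero]
    exact_mod_cast hev

theorem dim_torus (α : ℝ) {h : ℝ} (hh : h ≠ 0) (ev : ℝ) :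
    dim ↥(liftedEigenspace α h ev ⊓ isotypic (Pi.single 2 1) 0)
      = ∑' (l : ℤ) (k : ℤ), if torusEigenvalue α h l k = ev then 1 else 0 := by
  have hm : 0 < min 1 (h ^ 2) := lt_min one_pos (by positivity)
  rw [dim_eq_tsum_isotypic (E := liftedEigenspace α h ev ⊓ isotypic (Pi.single 2 1) 0)
    (v := Pi.single 1 1) (fun u hu => invariants_le_periodic_e1 hu.1.1)
    (fun u hu k => modeProj_e1_mem hu k)]
  · congr 1; ext l
    rw [dim_eq_tsum_isotypic (E := liftedEigenspace α h ev ⊓ isotypic (Pi.single 2 1) 0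
      ⊓ isotypic (Pi.single 1 1) l) (v := Pi.single 0 1) ?_ (fun u hu k => modeProj_e0_mem hu k)]
    · congr 1; ext k
      exact dim_torus_character α h ev l k
    · refine (finite_int_sq_le (c := min 1 (h ^ 2) * (4 * Real.pi ^ 2)) (by positivity) ev
        ).subset fun k hk => ?_
      obtain ⟨u, hu, hu0⟩ := (Submodule.ne_bot_iff _).1 hk
      obtain ⟨p, hp, hle⟩ := exists_gradient_bound α h hu.1.1.1.1
        (Module.End.mem_eigenspace_iff.1 hu.1.1.1.2) hu0
      have hpd := congrArg (fun w : Smooth => w.1 p) (pd_of_mem_isotypic hu.2)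
      change (pd 0 u).1 p = (2 * Real.pi * Complex.I * k : ℂ) * u.1 p at hpd
      rw [hpd, norm_two_pi_I_smul_sq] at hle
      have h1 : 0 < ‖u.1 p‖ ^ 2 := by positivity
      have h2 : min 1 (h ^ 2) * (4 * Real.pi ^ 2 * (k : ℝ) ^ 2 * ‖u.1 p‖ ^ 2)
          ≤ ev * ‖u.1 p‖ ^ 2 := by
        refine le_trans (mul_le_mul_of_nonneg_left ?_ hm.le) hle
        rw [add_assoc]
        exact le_add_of_nonneg_right (by positivity)
      refine le_of_mul_le_mul_right ?_ h1
      linarith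
    · intro u hu p
      have := hu.1.1.1 1 0 0 p
      rw [← this]
      -- Invariance under `γ(1, 0, 0)` is periodicity in `x` up to a shift in `z`, which is again
      -- invisible.
      have e : leftTrans ![((1 : ℤ) : ℝ), ((0 : ℤ) : ℝ), ((0 : ℤ) : ℝ)] p
          = p + Pi.single 0 1 + p 1 • Pi.single 2 1 := by
        ext i; fin_cases i <;> simp [leftTrans, add_comm]
      rw [e, isotypic_zero_apply hu.1.2]
  · refine (finite_int_sq_le (c := min 1 (h ^ 2) * (4 * Real.pi ^ 2)) (by positivity) ev
      ).subset fun k hk => ?_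
    obtain ⟨u, hu, hu0⟩ := (Submodule.ne_bot_iff _).1 hk
    obtain ⟨p, hp, hle⟩ := exists_gradient_bound α h hu.1.1.1
      (Module.End.mem_eigenspace_iff.1 hu.1.1.2) hu0
    have hvf : vf ![0, 1, 0] u = pd 1 u := by
      rw [vf_of_pd_two (pd_two_of_mem hu.1.2)]; simp
    have hpd := congrArg (fun w : Smooth => w.1 p) (pd_of_mem_isotypic hu.2)
    change (pd 1 u).1 p = (2 * Real.pi * Complex.I * k : ℂ) * u.1 p at hpd
    rw [hvf, hpd, norm_two_pi_I_smul_sq] at hle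
    have h1 : 0 < ‖u.1 p‖ ^ 2 := by positivity
    have h2 : min 1 (h ^ 2) * (4 * Real.pi ^ 2 * (k : ℝ) ^ 2 * ‖u.1 p‖ ^ 2)
        ≤ ev * ‖u.1 p‖ ^ 2 := by
      refine le_trans (mul_le_mul_of_nonneg_left ?_ hm.le) hle
      rw [add_right_comm]
      exact le_add_of_nonneg_left (by positivity)
    refine le_of_mul_le_mul_right ?_ h1
    linarith

/-! ### The ladder operators for a nontrivial central character -/

/-- Among `∂_x`, `∂_y + x ∂_z` and `∂_z` the only nonzero bracket is that of the first two, equal to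
`∂_z`. -/
theorem vf_comm (v w : Fin 3 → ℝ) :
    vf v * vf w = vf w * vf v + (v 0 * w 1 - v 1 * w 0 : ℂ) • pd 2 := by
  have hAB : pd 0 * (pd 1 + mulX * pd 2) = (pd 1 + mulX * pd 2) * pd 0 + pd 2 := by
    rw [mul_add, add_mul, pd_comm 0 1, ← mul_assoc, pd_zero_mul_mulX, add_mul, one_mul, mul_assoc,
      mul_assoc, pd_comm 0 2, add_assoc]
  have hCA : pd 2 * pd 0 = pd 0 * pd 2 := pd_comm 2 0
  have hCB : pd 2 * (pd 1 + mulX * pd 2) = (pd 1 + mulX * pd 2) * pd 2 := by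
    rw [mul_add, add_mul, pd_comm 2 1, ← mul_assoc, pd_mul_mulX (by decide)]
  unfold vf
  generalize pd 1 + mulX * pd 2 = B at *
  simp only [add_mul, mul_add, smul_mul_assoc, mul_smul_comm, hAB, hCA, hCB]
  module

theorem vf_comm_apply (v w : Fin 3 → ℝ) (u : Smooth) :
    vf v (vf w u) = vf w (vf v u) + (v 0 * w 1 - v 1 * w 0 : ℂ) • pd 2 u :=
  congrArg (fun T : Module.End ℂ Smooth => T u) (vf_comm v w)

/-- The lowering operator (for `σ n < 0`) on the functions of central character `n`. -/
def lower (α h σ : ℝ) : Module.End ℂ Smooth :=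
  vf ![1, α, 0] + (Complex.I * σ * h) • vf ![-α, 1, 0]

/-- The raising operator (for `σ n < 0`) on the functions of central character `n`. -/
def raise (α h σ : ℝ) : Module.End ℂ Smooth :=
  ((1 + (α : ℂ) ^ 2)⁻¹ : ℂ) • (vf ![1, α, 0] - (Complex.I * σ * h) • vf ![-α, 1, 0])

/-- The invariant functions of central character `n`. -/
def centralPart (n : ℤ) : Submodule ℂ Smooth := invariants ⊓ isotypic (Pi.single 2 1) n

theorem vf_mem_centralPart (v : Fin 3 → ℝ) {n : ℤ} {u : Smooth} (hu : u ∈ centralPart n) :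
    vf v u ∈ centralPart n :=
  ⟨vf_mem_invariants v hu.1, vf_mem_isotypic v (by decide) hu.2⟩

theorem isLadder (α : ℝ) {h σ : ℝ} {n : ℤ} (hh : 0 < h) (hn : n ≠ 0) (hσ : σ ^ 2 = 1)
    (hσn : σ * n = -|(n : ℝ)|) :
    IsLadder (centralPart n) (lap α h) (lower α h σ) (raise α h σ)
      (4 * Real.pi ^ 2 * n ^ 2 * h ^ 2 + 2 * Real.pi * |(n : ℝ)| * h)
      (2 * Real.pi * |(n : ℝ)| * h) := by
  have hc : (1 + (α : ℂ) ^ 2) ≠ 0 := by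
    have : (1 + α ^ 2 : ℝ) ≠ 0 := by positivity
    exact_mod_cast this
  have hci : (1 + (α : ℂ) ^ 2)⁻¹ * (1 + (α : ℂ) ^ 2) = 1 := inv_mul_cancel₀ hc
  have hσ' : (σ : ℂ) ^ 2 = 1 := by exact_mod_cast hσ
  have hσn' : (σ : ℂ) * n = -((|(n : ℝ)| : ℝ) : ℂ) := by exact_mod_cast hσn
  have hcomm : ∀ u ∈ centralPart n, vf ![1, α, 0] (vf ![-α, 1, 0] u)
      = vf ![-α, 1, 0] (vf ![1, α, 0] u)
        + ((1 + (α : ℂ) ^ 2) * (2 * Real.pi * Complex.I * n)) • u := by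
    intro u hu
    rw [vf_comm_apply, pd_of_mem_isotypic hu.2, smul_smul]
    congr 2
    simp
    left; ring
  have hlap : ∀ u ∈ centralPart n, lap α h u
      = -(((1 + (α : ℂ) ^ 2)⁻¹ : ℂ) • vf ![1, α, 0] (vf ![1, α, 0] u)
        + (h ^ 2 / (1 + α ^ 2) : ℂ) • vf ![-α, 1, 0] (vf ![-α, 1, 0] u)
        + (h ^ 2 * (2 * Real.pi * Complex.I * n) ^ 2 : ℂ) • u) := by
    intro u hu
    have : lap α h u = -(((1 + (α : ℂ) ^ 2)⁻¹ : ℂ) • vf ![1, α, 0] (vf ![1, α, 0] u)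
      + (h ^ 2 / (1 + α ^ 2) : ℂ) • vf ![-α, 1, 0] (vf ![-α, 1, 0] u)
      + (h ^ 2 : ℂ) • pd 2 (pd 2 u)) := rfl
    rw [this, pd_of_mem_isotypic hu.2, map_smul, pd_of_mem_isotypic hu.2]
    module
  refine ⟨?_, ?_, ?_, ?_, ?_, ?_⟩
  · have : (n : ℝ) ≠ 0 := by exact_mod_cast hn
    positivity
  · intro u hu
    exact Submodule.add_mem _ (vf_mem_centralPart _ hu)
      (Submodule.smul_mem _ _ (vf_mem_centralPart _ hu))
  · intro u hu
    exact Submodule.smul_mem _ _ (Submodule.sub_mem _ (vf_mem_centralPart _ hu)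
      (Submodule.smul_mem _ _ (vf_mem_centralPart _ hu)))
  · intro u hu
    have e : raise α h σ (lower α h σ u) = ((1 + (α : ℂ) ^ 2)⁻¹ : ℂ) •
        (vf ![1, α, 0] (vf ![1, α, 0] u + (Complex.I * σ * h) • vf ![-α, 1, 0] u)
        - (Complex.I * σ * h) •
          vf ![-α, 1, 0] (vf ![1, α, 0] u + (Complex.I * σ * h) • vf ![-α, 1, 0] u)) := rfl
    rw [e, hlap u hu]
    simp only [map_add, map_smul, hcomm u hu]
    generalize vf ![1, α, 0] (vf ![1, α, 0] u) = x
    generalize vf ![-α, 1, 0] (vf ![1, α, 0] u) = y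
    generalize vf ![-α, 1, 0] (vf ![-α, 1, 0] u) = z
    rw [div_eq_mul_inv]
    generalize (1 + (α : ℂ) ^ 2)⁻¹ = ci at *
    have hI := Complex.I_sq
    match_scalars
    · ring
    · ring
    -- The coefficient of `u`: the cross terms leave the commutator of `V` and `W`, and `σ n = -|n|`
    -- fixes its sign.
    · linear_combination (Complex.I ^ 2 * σ * h * 2 * Real.pi * n) * hci
        + (2 * Real.pi * h * σ * n - 4 * h ^ 2 * Real.pi ^ 2 * n ^ 2) * hI
        - (2 * Real.pi * h) * hσn'
    · linear_combination (-ci * h ^ 2 * σ ^ 2) * hI + (ci * h ^ 2) * hσ'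
  · intro u hu
    have e : lower α h σ (raise α h σ u) =
        vf ![1, α, 0] (((1 + (α : ℂ) ^ 2)⁻¹ : ℂ) •
          (vf ![1, α, 0] u - (Complex.I * σ * h) • vf ![-α, 1, 0] u))
        + (Complex.I * σ * h) • vf ![-α, 1, 0] (((1 + (α : ℂ) ^ 2)⁻¹ : ℂ) •
          (vf ![1, α, 0] u - (Complex.I * σ * h) • vf ![-α, 1, 0] u)) := rfl
    rw [e, hlap u hu]
    simp only [map_sub, map_smul, hcomm u hu]
    generalize vf ![1, α, 0] (vf ![1, α, 0] u) = x
    generalize vf ![-α, 1, 0] (vf ![1, α, 0] u) = y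
    generalize vf ![-α, 1, 0] (vf ![-α, 1, 0] u) = z
    rw [div_eq_mul_inv]
    generalize (1 + (α : ℂ) ^ 2)⁻¹ = ci at *
    have hI := Complex.I_sq
    match_scalars
    · ring
    · ring
    · linear_combination (-Complex.I ^ 2 * σ * h * 2 * Real.pi * n) * hci
        + (-2 * Real.pi * h * σ * n - 4 * h ^ 2 * Real.pi ^ 2 * n ^ 2) * hI
        + (2 * Real.pi * h) * hσn'
    · linear_combination (-ci * h ^ 2 * σ ^ 2) * hI + (ci * h ^ 2) * hσ'
  · intro ev hev
    refine eq_bot_iff.2 ?_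
    rw [← lap_nonneg α h hev]
    exact fun u hu => ⟨hu.1.1, hu.2⟩

/-- The slope of the complex direction annihilating the kernel of the lowering operator. -/
def slope (α h σ : ℝ) : ℂ := (α + Complex.I * σ * h) / (1 - Complex.I * σ * h * α)

theorem slope_den_ne_zero (α h σ : ℝ) : (1 - Complex.I * σ * h * α : ℂ) ≠ 0 := by
  intro h0
  have := congrArg Complex.re h0
  simp at this

/-- The imaginary part has the sign of `σ`, so `-n τ` lies in the upper half plane when `σ n =
-|n|`; the theta series then converges. -/
theorem slope_im (α h σ : ℝ) (hσ : σ ^ 2 = 1) :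
    (slope α h σ).im = σ * (h * (1 + α ^ 2) / (1 + h ^ 2 * α ^ 2)) := by
  have hd : 1 + h ^ 2 * α ^ 2 ≠ 0 := by positivity
  have hn : Complex.normSq (1 - Complex.I * σ * h * α) = 1 + h ^ 2 * α ^ 2 := by
    simp [Complex.normSq_apply]
    linear_combination (h ^ 2 * α ^ 2) * hσ
  rw [slope, Complex.div_im, hn]
  simp
  field_simp
  ring

theorem lower_eq_zero_iff (α h σ : ℝ) (u : Smooth) :
    lower α h σ u = 0 ↔ pd 0 u + slope α h σ • vf ![0, 1, 0] u = 0 := by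
  have hd := slope_den_ne_zero α h σ
  have : lower α h σ u
      = (1 - Complex.I * σ * h * α : ℂ) • (pd 0 u + slope α h σ • vf ![0, 1, 0] u) := by
    have h1 : slope α h σ * (1 - Complex.I * σ * h * α) = α + Complex.I * σ * h := by
      rw [slope, div_mul_cancel₀ _ hd]
    ext p
    change (vf ![1, α, 0] u).1 p + (Complex.I * σ * h) * (vf ![-α, 1, 0] u).1 p
      = (1 - Complex.I * σ * h * α : ℂ) * ((pd 0 u).1 p + slope α h σ * (vf ![0, 1, 0] u).1 p)
    have e1 : (vf ![1, α, 0] u).1 p = (pd 0 u).1 p + α * (vf ![0, 1, 0] u).1 p := by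
      simp [vf_apply]
    have e2 : (vf ![-α, 1, 0] u).1 p = -α * (pd 0 u).1 p + (vf ![0, 1, 0] u).1 p := by
      simp [vf_apply]
    rw [e1, e2]
    linear_combination (-(vf ![0, 1, 0] u).1 p) * h1
  rw [this]
  exact smul_eq_zero_iff_right hd

/-! ### Fourier coefficients of the functions of the lowest level -/

/-- The invariant functions of central character `n` annihilated by `∂_x + τ (∂_y + x ∂_z)`. -/
def vacuum (n : ℤ) (τ : ℂ) : Submodule ℂ Smooth :=
  centralPart n ⊓ LinearMap.ker (pd 0 + τ • vf ![0, 1, 0])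

/-- On the mode `k` in `y` and `n` in `z`, the kernel equation becomes `a' = -2πi τ (k + n x) a` in
the single variable `x`. A solution vanishing at one point vanishes identically, since `a` times the
exponential `ex (E x)` is constant. -/
theorem vacuum_coeff_eq_zero_iff {n k : ℤ} {τ : ℂ} {u : Smooth} (hu : u ∈ vacuum n τ)
    (x y : ℝ) : (modeProj (Pi.single 1 1) k u).1 ![x, 0, 0] = 0
      ↔ (modeProj (Pi.single 1 1) k u).1 ![y, 0, 0] = 0 := by
  set b := modeProj (Pi.single 1 1) k u with hb
  have hb1 : b ∈ isotypic (Pi.single 1 1) k :=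
    modeProj_mem_isotypic (invariants_le_periodic_e1 hu.1.1) k
  have hb2 : b ∈ isotypic (Pi.single 2 1) n := modeProj_mem_isotypic_of_mem hu.1.2
  have hker : pd 0 b + τ • vf ![0, 1, 0] b = 0 := by
    have c0 : modeProj (Pi.single 1 1) k (pd 0 u) = pd 0 b :=
      congrArg (fun T : Module.End ℂ Smooth => T u) (modeProj_comm_pd (Pi.single 1 1) k 0)
    have c1 : modeProj (Pi.single 1 1) k (vf ![0, 1, 0] u) = vf ![0, 1, 0] b :=
      congrArg (fun T : Module.End ℂ Smooth => T u) (modeProj_comm_vf (by simp) k ![0, 1, 0])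
    have h0 : pd 0 u + τ • vf ![0, 1, 0] u = 0 := hu.2
    rw [← c0, ← c1, ← map_smul, ← map_add, h0, map_zero]
  have hpd : ∀ p, (pd 0 b).1 p
      = -(2 * Real.pi * Complex.I) * (τ * (k + n * p 0)) * b.1 p := by
    intro p
    have h0 : (pd 0 b).1 p + τ * (vf ![0, 1, 0] b).1 p = 0 :=
      congrArg (fun w : Smooth => w.1 p) hker
    have h1 : (vf ![0, 1, 0] b).1 p = (2 * Real.pi * Complex.I) * (k + n * p 0) * b.1 p := by
      rw [vf_apply, pd_of_mem_isotypic hb1, pd_of_mem_isotypic hb2]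
      simp
      ring
    rw [h1] at h0
    linear_combination h0
  let a : ℝ → ℂ := fun x => b.1 ![x, 0, 0]
  let E : ℝ → ℂ := fun x => τ * (k * x + n * (x : ℂ) ^ 2 / 2)
  have ha : ∀ x, HasDerivAt a (-(2 * Real.pi * Complex.I) * (τ * (k + n * x)) * a x) x := by
    intro x
    have h1 := hasDerivAt_line b ![x, 0, 0] 0
    rw [hpd] at h1
    have h2 : (fun s : ℝ => b.1 (![x, 0, 0] + s • Pi.single 0 1)) = fun s => a (x + s) := by
      ext s
      have e : ![x, 0, 0] + s • Pi.single 0 1 = ![x + s, 0, 0] := by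
        ext i; fin_cases i <;> simp
      exact congrArg b.1 e
    rw [h2] at h1
    have h3 := HasDerivAt.comp_const_add (-x) x ((neg_add_cancel x).symm ▸ h1)
    simpa using h3
  have hE : ∀ x : ℝ, HasDerivAt E (τ * (k + n * x)) x := by
    intro x
    have hx : HasDerivAt (fun x : ℝ => (x : ℂ)) 1 x := Complex.ofRealCLM.hasDerivAt
    have := (((hx.const_mul (k : ℂ)).add
      (((hx.pow 2).const_mul (n : ℂ)).div_const 2)).const_mul τ)
    refine this.congr_deriv ?_
    simp
    left; ring
  have hprod : ∀ x, HasDerivAt (fun x => a x * ex (E x)) 0 x := by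
    intro x
    have := (ha x).mul ((hasDerivAt_ex (E x)).comp x (hE x))
    refine this.congr_deriv ?_
    simp only [Function.comp]
    ring
  have hconst : ∀ x y, a x * ex (E x) = a y * ex (E y) :=
    is_const_of_deriv_eq_zero (fun x => (hprod x).differentiableAt) (fun x => (hprod x).deriv)
  have key : ∀ x y, a x = 0 → a y = 0 := by
    intro x y hx
    have := hconst x y
    rw [hx, zero_mul] at this
    exact (mul_eq_zero.1 this.symm).resolve_right (ex_ne_zero _)
  exact ⟨key x y, key y x⟩

/-- Invariance under `γ(1, 0, 0)` gives `u(x, s, 0) = u(x + 1, s, s) = ex(n s) u(x + 1, s, 0)`, and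
the factor lowers the Fourier index by `n`. -/
theorem vacuum_coeff_shift {n : ℤ} {u : Smooth} (hu : u ∈ centralPart n) (k : ℤ) (x : ℝ) :
    (modeProj (Pi.single 1 1) k u).1 ![x, 0, 0]
      = (modeProj (Pi.single 1 1) (k - n) u).1 ![x + 1, 0, 0] := by
  rw [modeProj_apply, modeProj_apply]
  refine intervalIntegral.integral_congr fun s _ => ?_
  have h1 := hu.1 1 0 0 (![x, 0, 0] + s • Pi.single 1 1)
  have e : leftTrans ![((1 : ℤ) : ℝ), ((0 : ℤ) : ℝ), ((0 : ℤ) : ℝ)]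
      (![x, 0, 0] + s • Pi.single 1 1) = (![x + 1, 0, 0] + s • Pi.single 1 1) + s • Pi.single 2 1 := by
    ext i; fin_cases i <;> simp [leftTrans, Matrix.vecHead, Matrix.vecTail, add_comm]
  rw [e, hu.2] at h1
  simp only [← h1]
  rw [← mul_assoc, ← ex_add]
  congr 2
  push_cast; ring

/-- By the shift and the differential equation, the vanishing of the `k`-th coefficient depends only
on `k` modulo `n`; so the `|n|` residues control all coefficients. -/
theorem vacuum_eq_zero {n : ℤ} (hn : n ≠ 0) {τ : ℂ} {u : Smooth} (hu : u ∈ vacuum n τ)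
    (h : ∀ r : Fin n.natAbs, (modeProj (Pi.single 1 1) (r : ℤ) u).1 0 = 0) : u = 0 := by
  have h0 : (![0, 0, 0] : Fin 3 → ℝ) = 0 := by ext i; fin_cases i <;> rfl
  have hiff : ∀ k : ℤ, (modeProj (Pi.single 1 1) k u).1 0 = 0
      ↔ (modeProj (Pi.single 1 1) (k - n) u).1 0 = 0 := by
    intro k
    have := vacuum_coeff_shift hu.1 k 0
    rw [h0] at this
    rw [this, vacuum_coeff_eq_zero_iff hu (0 + 1) 0, h0]
  have hq : ∀ r q : ℤ, (modeProj (Pi.single 1 1) r u).1 0 = 0 →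
      (modeProj (Pi.single 1 1) (r + n * q) u).1 0 = 0 := by
    intro r q hr
    induction q using Int.induction_on with
    | zero => simpa using hr
    | succ i ih =>
      rw [hiff]
      convert ih using 3
      ring_nf
    | pred i ih =>
      rw [hiff] at ih
      convert ih using 3
      ring_nf
  have hk : ∀ k : ℤ, (modeProj (Pi.single 1 1) k u).1 0 = 0 := by
    intro k
    have h1 : 0 ≤ k % n := Int.emod_nonneg k hn
    have h2 : k % n < n.natAbs := by
      rw [Int.natCast_natAbs]; exact Int.emod_lt_abs k hn
    have h3 := h ⟨(k % n).toNat, by omega⟩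
    have h4 := hq _ (k / n) h3
    simp only [Int.toNat_of_nonneg h1] at h4
    rwa [Int.emod_add_mul_ediv] at h4
  refine eq_zero_of_modeProj_eq_zero (invariants_le_periodic_e1 hu.1.1) fun k => ?_
  ext p
  have hb1 := modeProj_mem_isotypic (invariants_le_periodic_e1 hu.1.1) k
  have hb2 : modeProj (Pi.single 1 1) k u ∈ isotypic (Pi.single 2 1) n :=
    modeProj_mem_isotypic_of_mem hu.1.2
  have hp : p = ![p 0, 0, 0] + p 1 • Pi.single 1 1 + p 2 • Pi.single 2 1 := by
    ext i; fin_cases i <;> simp [Matrix.vecHead, Matrix.vecTail]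
  rw [hp, hb2, hb1, (vacuum_coeff_eq_zero_iff hu (p 0) 0).2 (by rw [h0]; exact hk k)]
  simp

/-! ### Theta functions -/

theorem jacobiTheta₂_add_int (z τ : ℂ) (m : ℤ) : jacobiTheta₂ (z + m) τ = jacobiTheta₂ z τ := by
  induction m using Int.induction_on with
  | zero => simp
  | succ i ih =>
    rw [← ih, show z + ((i + 1 : ℤ) : ℂ) = z + (i : ℤ) + 1 by push_cast; ring,
      jacobiTheta₂_add_left]
  | pred i ih =>
    rw [← ih, show z + ((-i : ℤ) : ℂ) = z + ((-i - 1 : ℤ) : ℂ) + 1 by push_cast; ring,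
      jacobiTheta₂_add_left]

theorem jacobiTheta₂_add_int_mul (z τ : ℂ) (m : ℤ) :
    jacobiTheta₂ (z + m * τ) τ = ex (-(m ^ 2 * τ / 2) - m * z) * jacobiTheta₂ z τ := by
  have step : ∀ w, jacobiTheta₂ (w + τ) τ = ex (-(τ / 2) - w) * jacobiTheta₂ w τ := by
    intro w
    rw [jacobiTheta₂_add_left', ex]
    congr 2; ring
  induction m using Int.induction_on with
  | zero => simp [ex_zero]
  | succ i ih =>
    have e : z + ((i + 1 : ℤ) : ℂ) * τ = (z + (i : ℤ) * τ) + τ := by push_cast; ring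
    rw [e, step, ih, ← mul_assoc, ← ex_add]
    congr 2; push_cast; ring
  | pred i ih =>
    have e : z + ((-i : ℤ) : ℂ) * τ = (z + ((-i - 1 : ℤ) : ℂ) * τ) + τ := by push_cast; ring
    rw [e, step] at ih
    refine mul_left_cancel₀ (ex_ne_zero (-(τ / 2) - (z + ((-i - 1 : ℤ) : ℂ) * τ))) ?_
    rw [ih, ← mul_assoc, ← ex_add]
    congr 2; push_cast; ring

section Theta

variable {n : ℤ} {τ : ℂ}

theorem differentiable_jacobiTheta₂ (hτ : 0 < (-n * τ).im) :
    Differentiable ℂ fun z => jacobiTheta₂ z (-n * τ) :=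
  fun z => differentiableAt_jacobiTheta₂_fst z hτ

/-- The exponent of the automorphy factor of `thetaFunction`. -/
def thetaExponent (n : ℤ) (r : ℕ) (τ : ℂ) (p : Fin 3 → ℝ) : ℂ :=
  n * p 2 - n * τ * (p 0 : ℂ) ^ 2 / 2 + r * (p 1 - τ * p 0)

/-- The theta argument of `thetaFunction`. -/
def thetaArg (n : ℤ) (r : ℕ) (τ : ℂ) (p : Fin 3 → ℝ) : ℂ := n * (p 1 - τ * p 0) - r * τ

/-- The theta functions spanning `vacuum n τ`. -/
def thetaFunction (r : ℕ) (hτ : 0 < (-n * τ).im) : Smooth :=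
  ⟨fun p => ex (thetaExponent n r τ p) * jacobiTheta₂ (thetaArg n r τ p) (-n * τ), by
    have h : ∀ i : Fin 3, ContDiff ℝ ∞ fun p : Fin 3 → ℝ => (p i : ℂ) := fun i =>
      Complex.ofRealCLM.contDiff.comp (contDiff_apply ℝ ℝ i)
    have hw : ContDiff ℝ ∞ fun p : Fin 3 → ℝ => (p 1 - τ * p 0 : ℂ) :=
      (h 1).sub (contDiff_const.mul (h 0))
    have hth : ContDiff ℝ ∞ fun z => jacobiTheta₂ z (-n * τ) :=
      (differentiable_jacobiTheta₂ hτ).contDiff.restrict_scalars ℝ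
    refine mem_smoothFunctions.2 (ContDiff.mul (contDiff_ex.comp ?_) (hth.comp ?_))
    · exact ((contDiff_const.mul (h 2)).sub ((contDiff_const.mul ((h 0).pow 2)).div_const 2)).add
        (contDiff_const.mul hw)
    · exact (contDiff_const.mul hw).sub contDiff_const⟩

variable (hτ : 0 < (-n * τ).im)

theorem thetaFunction_apply (r : ℕ) (p : Fin 3 → ℝ) : (thetaFunction r hτ).1 p
    = ex (thetaExponent n r τ p) * jacobiTheta₂ (thetaArg n r τ p) (-n * τ) := rfl

/-- A translation by `a` in `x` moves the theta argument by `a` quasi-periods `-n τ`; the resulting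
factor is compensated by the exponent up to `ex` of an integer. -/
theorem thetaFunction_mem_centralPart (r : ℕ) : thetaFunction r hτ ∈ centralPart n := by
  constructor
  · intro a b c p
    rw [thetaFunction_apply, thetaFunction_apply]
    have e : thetaArg n r τ (leftTrans ![(a : ℝ), b, c] p)
        = (thetaArg n r τ p + a * (-n * τ)) + ((n * b : ℤ) : ℂ) := by
      simp [thetaArg, leftTrans]; ring
    rw [e, jacobiTheta₂_add_int, jacobiTheta₂_add_int_mul, ← mul_assoc, ← ex_add]
    have e2 : thetaExponent n r τ (leftTrans ![(a : ℝ), b, c] p)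
        + (-(a ^ 2 * (-n * τ) / 2) - a * thetaArg n r τ p)
        = thetaExponent n r τ p + ((n * c + r * b : ℤ) : ℂ) := by
      simp [thetaArg, thetaExponent, leftTrans]; ring
    rw [e2, ex_add, ex_int, mul_one]
  · intro p s
    rw [thetaFunction_apply, thetaFunction_apply, ← mul_assoc, ← ex_add]
    congr 2
    · simp [thetaExponent]; ring
    · simp [thetaArg]

/-- Here `A = 2πi u` collects the derivative of the exponential and `B` that of the theta factor. In
this form `∂_x + τ (∂_y + x ∂_z)` cancels for any `A` and `B`. -/
theorem thetaFunction_pd (r : ℕ) (p : Fin 3 → ℝ) :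
    ∃ A B : ℂ, (pd 0 (thetaFunction r hτ)).1 p = (-(n * τ * p 0) - r * τ) * A - τ * B
      ∧ (pd 1 (thetaFunction r hτ)).1 p = r * A + B
      ∧ (pd 2 (thetaFunction r hτ)).1 p = n * A := by
  set u := thetaFunction r hτ with hu
  let Φ : ℂ → ℂ := fun z => jacobiTheta₂ z (-n * τ)
  refine ⟨2 * Real.pi * Complex.I * u.1 p,
    ex (thetaExponent n r τ p) * (deriv Φ (thetaArg n r τ p) * n), ?_⟩
  have key : ∀ (i : Fin 3) (E' W' : ℂ),
      HasDerivAt (fun s : ℝ => thetaExponent n r τ (p + s • Pi.single i 1)) E' 0 →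
      HasDerivAt (fun s : ℝ => thetaArg n r τ (p + s • Pi.single i 1)) W' 0 →
      (pd i u).1 p = E' * (2 * Real.pi * Complex.I * u.1 p)
        + ex (thetaExponent n r τ p) * (deriv Φ (thetaArg n r τ p) * W') := by
    intro i E' W' hE hW
    have hΦ : HasDerivAt Φ (deriv Φ (thetaArg n r τ (p + (0 : ℝ) • Pi.single i 1)))
        (thetaArg n r τ (p + (0 : ℝ) • Pi.single i 1)) :=
      (differentiable_jacobiTheta₂ hτ _).hasDerivAt
    have h1 := ((hasDerivAt_ex _).comp (0 : ℝ) hE).mul (hΦ.comp (0 : ℝ) hW)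
    have h2 := (hasDerivAt_line u p i).unique h1
    rw [h2]
    simp only [Function.comp, zero_smul, add_zero]
    rw [hu, thetaFunction_apply]
    ring
  have hx : ∀ c : ℂ, HasDerivAt (fun x : ℝ => c + (x : ℂ)) 1 0 := fun c =>
    (Complex.ofRealCLM.hasDerivAt (x := (0 : ℝ))).const_add c
  refine ⟨?_, ?_, ?_⟩
  · rw [key 0 (-(n * τ * p 0) - r * τ) (-(n * τ))]
    · ring
    · have := ((((hx (p 0)).pow 2).const_mul (n * τ)).div_const 2).const_sub (n * p 2 : ℂ)
      have := this.add ((((hx (p 0)).const_mul τ).const_sub (p 1 : ℂ)).const_mul (r : ℂ))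
      refine (this.congr_of_eventuallyEq (Eventually.of_forall fun s => ?_)).congr_deriv ?_
      · simp [thetaExponent]
      · simp; ring
    · have := ((((hx (p 0)).const_mul τ).const_sub (p 1 : ℂ)).const_mul (n : ℂ)).sub_const (r * τ)
      refine (this.congr_of_eventuallyEq (Eventually.of_forall fun s => ?_)).congr_deriv ?_
      · simp [thetaArg]
      · simp
  · rw [key 1 r n]
    · have := (((hx (p 1)).sub_const (τ * p 0)).const_mul (r : ℂ)).const_add
        (n * p 2 - n * τ * (p 0 : ℂ) ^ 2 / 2)
      refine (this.congr_of_eventuallyEq (Eventually.of_forall fun s => ?_)).congr_deriv ?_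
      · simp [thetaExponent]
      · simp
    · have := (((hx (p 1)).sub_const (τ * p 0)).const_mul (n : ℂ)).sub_const (r * τ)
      refine (this.congr_of_eventuallyEq (Eventually.of_forall fun s => ?_)).congr_deriv ?_
      · simp [thetaArg]
      · simp
  · rw [key 2 n 0]
    · ring
    · have := (((hx (p 2)).const_mul (n : ℂ)).sub_const (n * τ * (p 0 : ℂ) ^ 2 / 2)).add_const
        (r * (p 1 - τ * p 0))
      refine (this.congr_of_eventuallyEq (Eventually.of_forall fun s => ?_)).congr_deriv ?_
      · simp [thetaExponent]
      · simp
    · simp only [thetaArg]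
      simp
      exact hasDerivAt_const _ _

theorem thetaFunction_mem_vacuum (r : ℕ) : thetaFunction r hτ ∈ vacuum n τ := by
  refine ⟨thetaFunction_mem_centralPart hτ r, ?_⟩
  refine LinearMap.mem_ker.2 ?_
  ext p
  obtain ⟨A, B, h0, h1, h2⟩ := thetaFunction_pd hτ r p
  change (pd 0 (thetaFunction r hτ)).1 p + τ * (vf ![0, 1, 0] (thetaFunction r hτ)).1 p = 0
  rw [vf_apply, h0, h1, h2]
  simp
  ring

/-- The theta series expands `thetaFunction r` on the `y`-axis into frequencies `r + m n`. As `0 ≤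
r, k < |n|`, frequency `k` occurs only for `m = 0` and `k = r`, where the theta coefficient is `1`.
-/
theorem thetaFunction_coeff (r k : Fin n.natAbs) :
    (modeProj (Pi.single 1 1) (k : ℤ) (thetaFunction r hτ)).1 0 = if k = r then 1 else 0 := by
  rw [modeProj_apply]
  set T : ℂ := -n * τ with hT
  let C : ℤ → ℂ := fun m => jacobiTheta₂_term m (-(r * τ)) T
  have hC : Summable C := (summable_jacobiTheta₂_term_iff _ _).2 hτ
  have hterm : ∀ (m : ℤ) (s : ℝ), jacobiTheta₂_term m (n * s - r * τ) T = ex (m * n * s) * C m := by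
    intro m s
    simp only [C, jacobiTheta₂_term, ex]
    rw [← Complex.exp_add]
    congr 1; ring
  have hval : ∀ s : ℝ, (thetaFunction r hτ).1 (0 + s • Pi.single 1 1)
      = ex (r * s) * jacobiTheta₂ (n * s - r * τ) T := by
    intro s
    rw [thetaFunction_apply]
    congr 2
    · simp [thetaExponent]
    · simp [thetaArg]
  have hnorm : ∀ x : ℝ, ‖ex x‖ = 1 := by
    intro x
    rw [ex, show (2 * Real.pi * Complex.I * x : ℂ) = ((2 * Real.pi * x : ℝ) : ℂ) * Complex.I by
      push_cast; ring]
    exact Complex.norm_exp_ofReal_mul_I _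
  have hF : ∀ (m : ℤ) (s : ℝ), ex (-((k : ℤ) * s)) * (ex (r * s) * (ex (m * n * s) * C m))
      = ex (((r + m * n - k : ℤ) : ℂ) * s) * C m := by
    intro m s
    rw [← mul_assoc, ← mul_assoc, ← ex_add, ← ex_add]
    congr 2; push_cast; ring
  have hsum : HasSum
      (fun m : ℤ => ∫ s in (0 : ℝ)..1, ex (((r + m * n - k : ℤ) : ℂ) * s) * C m)
      (∫ s in (0 : ℝ)..1, ex (-((k : ℤ) * s)) * (thetaFunction r hτ).1 (0 + s • Pi.single 1 1)) := by
    refine intervalIntegral.hasSum_integral_of_dominated_convergence (fun m _ => ‖C m‖)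
      (fun m => ?_) (fun m => ?_) ?_ ?_ ?_
    · exact ((continuous_ex.comp (by fun_prop)).mul continuous_const).aestronglyMeasurable
    · refine Eventually.of_forall fun s _ => ?_
      have := hnorm ((r + m * n - k : ℤ) * s)
      push_cast at this
      rw [norm_mul]
      push_cast
      rw [this, one_mul]
    · exact Eventually.of_forall fun s _ => hC.norm
    · exact intervalIntegrable_const
    · refine Eventually.of_forall fun s _ => ?_
      rw [hval]
      have h1 := ((hasSum_jacobiTheta₂_term (n * s - r * τ) hτ).mul_left (ex (r * s))).mul_left
        (ex (-((k : ℤ) * s)))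
      have h2 : (fun m : ℤ => ex (-((k : ℤ) * s))
          * (ex (r * s) * jacobiTheta₂_term m (n * s - r * τ) (-n * τ)))
          = fun m : ℤ => ex (((r + m * n - k : ℤ) : ℂ) * s) * C m := by
        ext m
        rw [hterm m s, hF]
      rwa [h2] at h1
  have hint : ∀ m : ℤ, ∫ s in (0 : ℝ)..1, ex (((r + m * n - k : ℤ) : ℂ) * s) * C m
      = if m = 0 then (if k = r then 1 else 0) else 0 := by
    intro m
    rw [intervalIntegral.integral_mul_const, integral_ex_int]
    have hr := r.2
    have hk := k.2
    by_cases hm : m = 0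
    · subst hm
      by_cases hkr : k = r
      · subst hkr; simp [C, jacobiTheta₂_term]
      · have : ¬ ((r : ℕ) + 0 * n - (k : ℕ) : ℤ) = 0 := by
          intro h; apply hkr; apply Fin.ext; omega
        rw [if_neg this]; simp [hkr]
    · rw [if_neg hm, if_neg, zero_mul]
      intro h
      have h1 : m * n = (k : ℤ) - r := by linarith
      have h2 : (m * n).natAbs < n.natAbs := by rw [h1]; omega
      rw [Int.natAbs_mul] at h2
      have h3 : 1 ≤ m.natAbs := Int.natAbs_pos.2 hm
      nlinarith
  simp only [hint] at hsum
  have h0 := hasSum_ite_eq (0 : ℤ) (if k = r then (1 : ℂ) else 0)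
  exact hsum.unique h0

end Theta

theorem dim_vacuum {n : ℤ} (hn : n ≠ 0) {τ : ℂ} (hτ : 0 < (-n * τ).im) :
    dim (vacuum n τ) = n.natAbs := by
  let T : vacuum n τ →ₗ[ℂ] (Fin n.natAbs → ℂ) :=
    { toFun := fun u r => (modeProj (Pi.single 1 1) (r : ℤ) u.1).1 0
      map_add' := fun u w => by ext r; simp
      map_smul' := fun c u => by ext r; simp }
  have hT : ∀ (u : vacuum n τ) (r : Fin n.natAbs),
      T u r = (modeProj (Pi.single 1 1) (r : ℤ) u.1).1 0 := fun _ _ => rfl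
  have hinj : Function.Injective T := by
    rw [injective_iff_map_eq_zero]
    intro u hu
    exact Subtype.ext (vacuum_eq_zero hn u.2 fun r => by rw [← hT, hu]; rfl)
  have hsurj : Function.Surjective T := by
    intro g
    -- The theta functions are dual to the coordinates of `T`.
    refine ⟨∑ r, g r • ⟨thetaFunction r hτ, thetaFunction_mem_vacuum hτ r⟩, ?_⟩
    ext k
    rw [map_sum, Finset.sum_apply]
    simp [hT, thetaFunction_coeff hτ]
  rw [dim_congr (LinearEquiv.ofBijective T ⟨hinj, hsurj⟩), dim, rank_fin_fun]
  simp

theorem dim_central (α : ℝ) {h : ℝ} (hh : 0 < h) {n : ℤ} (hn : n ≠ 0) (ev : ℝ) :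
    dim ↥(liftedEigenspace α h ev ⊓ isotypic (Pi.single 2 1) n)
      = ∑' j : ℕ, if 4 * Real.pi ^ 2 * n ^ 2 * h ^ 2 + 2 * Real.pi * |(n : ℝ)| * h
          + 2 * (2 * Real.pi * |(n : ℝ)| * h) * j = ev then (n.natAbs : ℝ≥0∞) else 0 := by
  have hnR : (n : ℝ) ≠ 0 := by exact_mod_cast hn
  obtain ⟨σ, hσ, hσn⟩ : ∃ σ : ℝ, σ ^ 2 = 1 ∧ σ * n = -|(n : ℝ)| := by
    rcases abs_choice (n : ℝ) with h | h
    · exact ⟨-1, by norm_num, by rw [h]; ring⟩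
    · exact ⟨1, by norm_num, by rw [h]; ring⟩
  have hL := isLadder α hh hn hσ hσn
  have hτ : 0 < (-n * slope α h σ).im := by
    have : (-(n : ℂ) * slope α h σ).im = -(n : ℝ) * (slope α h σ).im := by
      rw [← Complex.im_ofReal_mul]; push_cast; rfl
    rw [this, slope_im α h σ hσ]
    have h2 : -(n : ℝ) * (σ * (h * (1 + α ^ 2) / (1 + h ^ 2 * α ^ 2)))
        = |(n : ℝ)| * (h * (1 + α ^ 2) / (1 + h ^ 2 * α ^ 2)) := by
      linear_combination (-(h * (1 + α ^ 2) / (1 + h ^ 2 * α ^ 2))) * hσn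
    rw [h2]
    positivity
  have h1 : liftedEigenspace α h ev ⊓ isotypic (Pi.single 2 1) n
      = centralPart n ⊓ Module.End.eigenspace (lap α h) (ev : ℂ) := by
    rw [liftedEigenspace, centralPart, inf_right_comm]
  have h2 : centralPart n ⊓ LinearMap.ker (lower α h σ) = vacuum n (slope α h σ) := by
    ext u
    constructor
    · exact fun hu => ⟨hu.1, (lower_eq_zero_iff α h σ u).1 hu.2⟩
    · exact fun hu => ⟨hu.1, (lower_eq_zero_iff α h σ u).2 hu.2⟩
  rw [h1, hL.dim_eigenspace ev, h2, dim_vacuum hn hτ]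

/-! ### The heat trace as an explicit sum -/

/-- The contribution of the functions on the base torus to the heat trace. -/
def torusTrace (α h t : ℝ) : ℝ≥0∞ :=
  ∑' (l : ℤ) (k : ℤ), ENNReal.ofReal (Real.exp (-t * torusEigenvalue α h l k))

/-- The function whose integral is the leading coefficient of the heat trace. -/
def density (t η : ℝ) : ℝ := η / Real.sinh (t * η) * Real.exp (-t * η ^ 2)

theorem tsum_ite_mul (c : ℝ) (a : ℝ≥0∞) (w : ℝ → ℝ≥0∞) :
    ∑' ev : ℝ, (if c = ev then a else 0) * w ev = a * w c := by
  rw [tsum_eq_single c]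
  · simp
  · intro b hb
    rw [if_neg hb.symm, zero_mul]

theorem multiplicity_eq (α : ℝ) {h : ℝ} (hh : 0 < h) (ev : ℝ) :
    (multiplicity α h ev : ℝ≥0∞)
      = (∑' (l : ℤ) (k : ℤ), if torusEigenvalue α h l k = ev then 1 else 0)
        + ∑' (n : ℤ) (j : ℕ), if 4 * Real.pi ^ 2 * n ^ 2 * h ^ 2 + 2 * Real.pi * |(n : ℝ)| * h
          + 2 * (2 * Real.pi * |(n : ℝ)| * h) * j = ev then (n.natAbs : ℝ≥0∞) else 0 := by
  have h1 : (multiplicity α h ev : ℝ≥0∞) = dim (liftedEigenspace α h ev) := by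
    rw [multiplicity, rank_eigenspace α hh.ne', dim]
  have h2 : ∀ n : ℤ, dim ↥(liftedEigenspace α h ev ⊓ isotypic (Pi.single 2 1) n)
      = (if n = 0 then ∑' (l : ℤ) (k : ℤ), if torusEigenvalue α h l k = ev then 1 else 0 else 0)
        + ∑' j : ℕ, if 4 * Real.pi ^ 2 * n ^ 2 * h ^ 2 + 2 * Real.pi * |(n : ℝ)| * h
          + 2 * (2 * Real.pi * |(n : ℝ)| * h) * j = ev then (n.natAbs : ℝ≥0∞) else 0 := by
    intro n
    -- For `n = 0` the oscillator sum vanishes because its weight is `|n| = 0`, so one sum over all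
    -- `n` serves.
    by_cases hn : n = 0
    · subst hn
      rw [dim_torus α hh.ne']
      simp
    · rw [dim_central α hh hn, if_neg hn, zero_add]
  rw [h1, dim_lifted_eq_tsum α hh.ne', tsum_congr h2, ENNReal.tsum_add, tsum_ite_eq]

theorem tsum_oscillator {t h : ℝ} (ht : 0 < t) (hh : 0 < h) (n : ℤ) :
    ∑' j : ℕ, (n.natAbs : ℝ≥0∞) * ENNReal.ofReal (Real.exp (-t *
      (4 * Real.pi ^ 2 * n ^ 2 * h ^ 2 + 2 * Real.pi * |(n : ℝ)| * h
          + 2 * (2 * Real.pi * |(n : ℝ)| * h) * j)))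
      = ENNReal.ofReal ((4 * Real.pi * h)⁻¹ * density t (2 * Real.pi * h * n)) := by
  -- At `n = 0` the left side has weight `0`, and on the right `density t 0 = 0` since division by
  -- `sinh 0 = 0` gives `0`. The limit of `density` at `0` is `t⁻¹`, so it is discontinuous there.
  by_cases hn : n = 0
  · subst hn; simp [density]
  have hn' : 0 < |(n : ℝ)| := by
    rw [abs_pos]; exact_mod_cast hn
  have hpi := Real.pi_pos
  set x : ℝ := t * (2 * Real.pi * |(n : ℝ)| * h) with hx
  have hx0 : 0 < x := by positivity
  have hq1 : Real.exp (-(2 * x)) < 1 := by rw [Real.exp_lt_one_iff]; linarith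
  have hterm : ∀ j : ℕ, Real.exp (-t * (4 * Real.pi ^ 2 * n ^ 2 * h ^ 2
      + 2 * Real.pi * |(n : ℝ)| * h + 2 * (2 * Real.pi * |(n : ℝ)| * h) * j))
      = Real.exp (-t * (2 * Real.pi * h * n) ^ 2) * Real.exp (-x) * Real.exp (-(2 * x)) ^ j := by
    intro j
    rw [← Real.exp_nat_mul, ← Real.exp_add, ← Real.exp_add]
    congr 1
    rw [hx]; ring
  have hgeom := (hasSum_geometric_of_lt_one (Real.exp_nonneg _) hq1).mul_left
    (Real.exp (-t * (2 * Real.pi * h * n) ^ 2) * Real.exp (-x))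
  rw [ENNReal.tsum_mul_left]
  simp only [hterm]
  rw [← ENNReal.ofReal_tsum_of_nonneg (fun j => by positivity) hgeom.summable, hgeom.tsum_eq]
  have hnat : (n.natAbs : ℝ≥0∞) = ENNReal.ofReal |(n : ℝ)| := by
    rw [← Int.cast_abs, Int.abs_eq_natAbs, Int.cast_natCast, ENNReal.ofReal_natCast]
  rw [hnat, ← ENNReal.ofReal_mul (abs_nonneg _)]
  congr 1
  have heven : density t (2 * Real.pi * h * n)
      = (2 * Real.pi * h * |(n : ℝ)|) / Real.sinh x
        * Real.exp (-t * (2 * Real.pi * h * n) ^ 2) := by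
    rw [density]
    congr 1
    rcases abs_choice (n : ℝ) with hab | hab
    · rw [hx, hab]; congr 2; ring
    · have e1 : 2 * Real.pi * h * |(n : ℝ)| = -(2 * Real.pi * h * n) := by rw [hab]; ring
      have e2 : x = -(t * (2 * Real.pi * h * n)) := by rw [hx, hab]; ring
      rw [e1, e2, Real.sinh_neg, neg_div_neg_eq]
  rw [heven]
  -- The sum of the geometric series in `exp(-2x)`, started at `exp(-x)`.
  have hs : Real.exp (-x) * (1 - Real.exp (-(2 * x)))⁻¹ = (2 * Real.sinh x)⁻¹ := by
    have h1 : Real.exp (-(2 * x)) = Real.exp (-x) * Real.exp (-x) := by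
      rw [← Real.exp_add]; congr 1; ring
    have h2 : Real.exp x * Real.exp (-x) = 1 := by rw [← Real.exp_add]; simp
    have h3 : 0 < Real.sinh x := Real.sinh_pos_iff.2 hx0
    have h4 : 2 * Real.sinh x = Real.exp x - Real.exp (-x) := by rw [Real.sinh_eq]; ring
    have h5 : 1 - Real.exp (-(2 * x)) ≠ 0 := by linarith
    rw [← div_eq_mul_inv, div_eq_iff h5, inv_mul_eq_div, eq_div_iff (by positivity), h4, h1]
    linear_combination h2
  have hs0 : Real.sinh x ≠ 0 := (Real.sinh_pos_iff.2 hx0).ne'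
  rw [mul_assoc (Real.exp (-t * (2 * Real.pi * h * n) ^ 2)), hs]
  field_simp
  ring

/-- In `ℝ≥0∞` the sums may be exchanged freely, even over the uncountable index `ev`; the sum over
`ev` then selects one eigenvalue per label. -/
theorem heatTrace_eq (α : ℝ) {t h : ℝ} (ht : 0 < t) (hh : 0 < h) :
    heatTrace α h t = torusTrace α h t
      + ∑' n : ℤ, ENNReal.ofReal ((4 * Real.pi * h)⁻¹ * density t (2 * Real.pi * h * n)) := by
  rw [heatTrace]
  simp only [multiplicity_eq α hh, add_mul, ENNReal.tsum_add, ← ENNReal.tsum_mul_right]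
  congr 1
  · rw [ENNReal.tsum_comm, torusTrace]
    refine tsum_congr fun l => ?_
    rw [ENNReal.tsum_comm]
    refine tsum_congr fun k => ?_
    rw [tsum_ite_mul (torusEigenvalue α h l k) 1 fun ev => ENNReal.ofReal (Real.exp (-t * ev)),
      one_mul]
  · rw [ENNReal.tsum_comm]
    refine tsum_congr fun n => ?_
    rw [ENNReal.tsum_comm, ← tsum_oscillator ht hh]
    refine tsum_congr fun j => ?_
    rw [tsum_ite_mul _ _ fun ev => ENNReal.ofReal (Real.exp (-t * ev))]

/-! ### Riemann sums of rapidly decreasing functions -/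

section RiemannSum

variable {F : ℝ → ℝ} {C c : ℝ}

/-- This provides one integrable majorant for all step functions `F (a ⌊x / a⌋)` with `a ≤ 1`. The
exponent comes from `x² / 2 ≤ (x - y)² + y²`. -/
theorem gaussian_bound_of_near (hc : 0 < c) (hF : ∀ x, |F x| ≤ C * Real.exp (-c * x ^ 2))
    {x y : ℝ} (hxy : |x - y| ≤ 1) : |F y| ≤ C * Real.exp c * Real.exp (-(c / 2) * x ^ 2) := by
  have hC : 0 ≤ C := by
    have := (abs_nonneg _).trans (hF 0)
    simpa using this
  refine (hF y).trans ?_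
  rw [mul_assoc, ← Real.exp_add]
  refine mul_le_mul_of_nonneg_left (Real.exp_le_exp.2 ?_) hC
  have h1 : (x - y) ^ 2 ≤ 1 := by
    rw [← sq_abs]; nlinarith [abs_nonneg (x - y)]
  have h2 : x ^ 2 / 2 ≤ 1 + y ^ 2 := by nlinarith [sq_nonneg (x - 2 * y)]
  nlinarith

theorem abs_sub_mul_floor_le {a : ℝ} (ha : 0 < a) (x : ℝ) : |x - a * ⌊x / a⌋| ≤ a := by
  have h1 := Int.floor_le (x / a)
  have h2 := Int.lt_floor_add_one (x / a)
  rw [le_div_iff₀ ha] at h1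
  rw [div_lt_iff₀ ha] at h2
  rw [abs_le]
  constructor <;> nlinarith

theorem hasSum_integral_floor {f : ℝ → ℝ} (hf : Integrable fun u : ℝ => f ⌊u⌋) :
    HasSum (fun n : ℤ => f n) (∫ u : ℝ, f ⌊u⌋) := by
  have h := hasSum_integral_iUnion (μ := volume) (f := fun u : ℝ => f ⌊u⌋)
    (s := fun n : ℤ => Set.Ico (n : ℝ) (n + 1)) (fun n => measurableSet_Ico)
    (Set.pairwise_disjoint_Ico_intCast ℝ) hf.integrableOn
  rw [iUnion_Ico_intCast, setIntegral_univ] at h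
  have key : ∀ n : ℤ, ∫ u in Set.Ico (n : ℝ) (n + 1), f ⌊u⌋ = f n := by
    intro n
    have : ∫ u in Set.Ico (n : ℝ) (n + 1), f ⌊u⌋ = ∫ u in Set.Ico (n : ℝ) (n + 1), f n := by
      refine setIntegral_congr_fun measurableSet_Ico fun u hu => ?_
      rw [Int.floor_eq_iff.2 ⟨hu.1, hu.2⟩]
    rw [this, setIntegral_const]
    simp
  simpa only [key] using h

theorem integrable_gaussian_mul (C : ℝ) (hc : 0 < c) :
    Integrable fun x : ℝ => C * Real.exp (-c * x ^ 2) :=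
  (integrable_exp_neg_mul_sq hc).const_mul C

theorem integrable_of_gaussian_bound (hc : 0 < c) (hm : Measurable F)
    (hF : ∀ x, |F x| ≤ C * Real.exp (-c * x ^ 2)) : Integrable F :=
  (integrable_gaussian_mul C hc).mono' hm.aestronglyMeasurable (Eventually.of_forall hF)

theorem hasSum_riemann (hc : 0 < c) (hm : Measurable F)
    (hF : ∀ x, |F x| ≤ C * Real.exp (-c * x ^ 2)) {a : ℝ} (ha : 0 < a) :
    HasSum (fun n : ℤ => F (a * n)) (a⁻¹ * ∫ x, F (a * ⌊x / a⌋)) := by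
  have hmeas : Measurable fun u : ℝ => F (a * ⌊u⌋) :=
    hm.comp ((measurable_from_top.comp Int.measurable_floor).const_mul a)
  have hint : Integrable fun u : ℝ => F (a * ⌊u⌋) := by
    refine integrable_of_gaussian_bound (F := fun u : ℝ => F (a * ⌊u⌋)) (c := c * a ^ 2 / 2)
      (C := C * Real.exp (c * a ^ 2)) (by positivity) hmeas fun u => ?_
    have := gaussian_bound_of_near (F := fun u => F (a * u)) (C := C) (c := c * a ^ 2)
      (by positivity) (fun x => (hF _).trans_eq (by congr 2; ring)) (x := u) (y := ⌊u⌋)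
      (by simpa using abs_sub_mul_floor_le one_pos u)
    refine this.trans_eq (by congr 2)
  have h := hasSum_integral_floor (f := fun u => F (a * u)) hint
  convert h using 1
  have := Measure.integral_comp_div (fun u : ℝ => F (a * ⌊u⌋)) a
  rw [this, abs_of_pos ha, smul_eq_mul, inv_mul_cancel_left₀ ha.ne']

/-- Riemann sums over `a ℤ` of a function of Gaussian decay converge to its integral. -/
theorem tendsto_riemann (hc : 0 < c) (hm : Measurable F)
    (hF : ∀ x, |F x| ≤ C * Real.exp (-c * x ^ 2)) (hcont : ∀ x, x ≠ 0 → ContinuousAt F x) :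
    Tendsto (fun a : ℝ => a * ∑' n : ℤ, F (a * n)) (𝓝[>] 0) (𝓝 (∫ x, F x)) := by
  -- The Riemann sum is the integral of a step function, to which dominated convergence applies.
  have h1 : Tendsto (fun a : ℝ => ∫ x, F (a * ⌊x / a⌋)) (𝓝[>] 0) (𝓝 (∫ x, F x)) := by
    refine tendsto_integral_filter_of_dominated_convergence
      (fun x => C * Real.exp c * Real.exp (-(c / 2) * x ^ 2)) ?_ ?_ ?_ ?_
    · refine Eventually.of_forall fun a => Measurable.aestronglyMeasurable ?_
      exact hm.comp ((measurable_from_top.comp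
        (Int.measurable_floor.comp (measurable_id.div_const a))).const_mul a)
    · have : ∀ᶠ a : ℝ in 𝓝[>] 0, a ∈ Set.Ioc (0 : ℝ) 1 := Ioc_mem_nhdsGT one_pos
      filter_upwards [this] with a ha
      exact Eventually.of_forall fun x => gaussian_bound_of_near hc hF
        ((abs_sub_mul_floor_le ha.1 x).trans ha.2)
    · exact integrable_gaussian_mul _ (by positivity)
    -- Continuity away from the null set `{0}` is enough, which admits `density`.
    · have h0 : ∀ᵐ x : ℝ, x ≠ 0 := by simp [ae_iff, measure_singleton]
      filter_upwards [h0] with x hx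
      refine (hcont x hx).tendsto.comp ?_
      rw [tendsto_iff_norm_sub_tendsto_zero]
      refine squeeze_zero' (Eventually.of_forall fun _ => norm_nonneg _) ?_
        (tendsto_nhdsWithin_of_tendsto_nhds tendsto_id)
      filter_upwards [self_mem_nhdsWithin] with a ha
      rw [norm_sub_rev]
      exact abs_sub_mul_floor_le ha x
  refine h1.congr' ?_
  filter_upwards [self_mem_nhdsWithin] with a ha
  rw [(hasSum_riemann hc hm hF ha).tsum_eq, mul_inv_cancel_left₀ (ne_of_gt ha)]

end RiemannSum

/-! ### Properties of the density -/

theorem density_nonneg {t : ℝ} (ht : 0 < t) (x : ℝ) : 0 ≤ density t x := by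
  refine mul_nonneg ?_ (Real.exp_nonneg _)
  rcases le_total 0 x with hx | hx
  · exact div_nonneg hx (Real.sinh_nonneg_iff.2 (by positivity))
  · exact div_nonneg_of_nonpos hx (Real.sinh_nonpos_iff.2 (mul_nonpos_of_nonneg_of_nonpos ht.le hx))

theorem div_sinh_le {t : ℝ} (ht : 0 < t) {x : ℝ} (hx : 0 ≤ x) : x / Real.sinh (t * x) ≤ t⁻¹ := by
  rcases hx.eq_or_lt with rfl | hx
  · simp [ht.le]
  · have h1 : t * x ≤ Real.sinh (t * x) := Real.self_le_sinh_iff.2 (by positivity)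
    rw [div_le_iff₀ (Real.sinh_pos_iff.2 (by positivity)), inv_mul_eq_div, le_div_iff₀ ht]
    linarith

theorem abs_density_le {t : ℝ} (ht : 0 < t) (x : ℝ) :
    |density t x| ≤ t⁻¹ * Real.exp (-t * x ^ 2) := by
  rw [abs_of_nonneg (density_nonneg ht x), density]
  refine mul_le_mul_of_nonneg_right ?_ (Real.exp_nonneg _)
  rcases le_total 0 x with hx | hx
  · exact div_sinh_le ht hx
  · have := div_sinh_le ht (neg_nonneg.2 hx)
    rwa [mul_neg, Real.sinh_neg, neg_div_neg_eq] at this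

theorem measurable_density (t : ℝ) : Measurable (density t) := by
  unfold density
  exact (measurable_id.div (Real.measurable_sinh.comp (measurable_id.const_mul t))).mul
    (Real.measurable_exp.comp ((measurable_id.pow_const 2).const_mul (-t)))

theorem continuousAt_density {t : ℝ} (ht : 0 < t) {x : ℝ} (hx : x ≠ 0) :
    ContinuousAt (density t) x := by
  unfold density
  refine ContinuousAt.mul (ContinuousAt.div continuousAt_id ?_ ?_) ?_
  · exact (Real.continuous_sinh.comp (by fun_prop)).continuousAt
  · rw [Ne, Real.sinh_eq_zero]
    exact mul_ne_zero ht.ne' hx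
  · fun_prop

/-! ### The contribution of the torus -/

/-- With `A = (1 + α²)⁻¹`, `u = k + α l` and `v = l - α k`, the eigenvalue is `4π² A (u² + h² v²)`
and `l = A (v + α u)`. Half of the `u²` term is kept to sum over `k`; the other half and the `v²`
term dominate `π² m² l²`. -/
theorem torusEigenvalue_ge (α : ℝ) {h m : ℝ} (hm0 : 0 ≤ m) (hm1 : m ≤ 1) (hmh : m ≤ h) (l k : ℤ) :
    2 * Real.pi ^ 2 * (1 + α ^ 2)⁻¹ * (k + α * l) ^ 2 + Real.pi ^ 2 * m ^ 2 * l ^ 2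
      ≤ torusEigenvalue α h l k := by
  have hpi := Real.pi_pos
  rw [torusEigenvalue, div_eq_mul_inv]
  set u : ℝ := k + α * l with hu
  set v : ℝ := l - α * k with hv
  have hl : (l : ℝ) * (1 + α ^ 2) = v + α * u := by rw [hu, hv]; ring
  set A := (1 + α ^ 2)⁻¹ with hA
  have hA0 : 0 < A := by positivity
  have hA1 : A * (1 + α ^ 2) = 1 := inv_mul_cancel₀ (by positivity)
  have hl' : (l : ℝ) = A * (v + α * u) := by rw [← hl]; linear_combination (-(l : ℝ)) * hA1
  have hm2 : m ^ 2 ≤ h ^ 2 := by gcongr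
  have hm3 : m ^ 2 ≤ 1 := by nlinarith
  have hAle : A ≤ 1 := by rw [hA]; exact inv_le_one_of_one_le₀ (by nlinarith [sq_nonneg α])
  have hAα : A * α ^ 2 ≤ 1 := by nlinarith
  have e1 : (l : ℝ) ^ 2 ≤ 2 * A ^ 2 * v ^ 2 + 2 * A * u ^ 2 := by
    have : (l : ℝ) ^ 2 ≤ 2 * (A * v) ^ 2 + 2 * (A * α * u) ^ 2 := by
      rw [hl']; nlinarith [sq_nonneg (A * v - A * α * u)]
    have h2 : (A * α * u) ^ 2 ≤ A * u ^ 2 := by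
      have : (A * α * u) ^ 2 = (A * α ^ 2) * (A * u ^ 2) := by ring
      rw [this]
      exact mul_le_of_le_one_left (by positivity) hAα
    nlinarith
  have e2 : m ^ 2 * (l : ℝ) ^ 2 ≤ 2 * A * h ^ 2 * v ^ 2 + 2 * A * u ^ 2 := by
    have h1 : m ^ 2 * (2 * A ^ 2 * v ^ 2) ≤ 2 * A * h ^ 2 * v ^ 2 := by
      have : m ^ 2 * (A * (2 * A * v ^ 2)) ≤ h ^ 2 * (1 * (2 * A * v ^ 2)) := by gcongr
      nlinarith
    have h2 : m ^ 2 * (2 * A * u ^ 2) ≤ 1 * (2 * A * u ^ 2) := by gcongr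
    have h3 := mul_le_mul_of_nonneg_left e1 (sq_nonneg m)
    nlinarith
  have e3 : 0 ≤ A * h ^ 2 * v ^ 2 := by positivity
  have := mul_le_mul_of_nonneg_left e2 (sq_nonneg Real.pi)
  nlinarith [mul_nonneg (sq_nonneg Real.pi) e3]

theorem gaussian_self_bound {c : ℝ} (x : ℝ) :
    |Real.exp (-c * x ^ 2)| ≤ 1 * Real.exp (-c * x ^ 2) := by
  rw [abs_of_pos (Real.exp_pos _), one_mul]

theorem measurable_gaussian (c : ℝ) : Measurable fun x : ℝ => Real.exp (-c * x ^ 2) := by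
  fun_prop

/-- Reindexing by `⌊s⌋` reduces to a shift in `[0, 1)`, where one Gaussian majorant serves for all
`s`. -/
theorem exists_tsum_gaussian_shift_le {c : ℝ} (hc : 0 < c) :
    ∃ K : ℝ, 0 ≤ K ∧ ∀ s : ℝ,
      ∑' k : ℤ, ENNReal.ofReal (Real.exp (-c * (k + s) ^ 2)) ≤ ENNReal.ofReal K := by
  have hsum := (hasSum_riemann (half_pos hc) (measurable_gaussian (c / 2)) gaussian_self_bound
    one_pos).summable.mul_left (Real.exp c)
  simp only [one_mul] at hsum
  refine ⟨∑' k : ℤ, Real.exp c * Real.exp (-(c / 2) * (k : ℝ) ^ 2),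
    tsum_nonneg fun k => by positivity, fun s => ?_⟩
  rw [ENNReal.ofReal_tsum_of_nonneg (fun k => by positivity) hsum,
    ← (Equiv.addRight (-⌊s⌋)).tsum_eq]
  refine ENNReal.tsum_le_tsum fun k => ENNReal.ofReal_le_ofReal ?_
  have h1 : |(k : ℝ) - (((Equiv.addRight (-⌊s⌋)) k : ℤ) + s)| ≤ 1 := by
    have h2 := Int.floor_le s
    have h3 := Int.lt_floor_add_one s
    rw [abs_le]
    push_cast [Equiv.coe_addRight]
    constructor <;> linarith
  have := gaussian_bound_of_near hc gaussian_self_bound h1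
  rwa [abs_of_pos (Real.exp_pos _), one_mul] at this

/-- The sum over `k` is bounded uniformly in `l` and `h`. What remains is a one-dimensional Gaussian
sum of step `min 1 h`, of order `h⁻¹` as `h → 0`. -/
theorem exists_torusTrace_le (α : ℝ) {t : ℝ} (ht : 0 < t) :
    ∃ K : ℝ, 0 ≤ K ∧ ∀ h : ℝ, 0 < h → torusTrace α h t
      ≤ ENNReal.ofReal (K * ∑' l : ℤ, Real.exp (-(t * Real.pi ^ 2) * (min 1 h * l) ^ 2)) := by
  have hpi := Real.pi_pos
  obtain ⟨K, hK0, hK⟩ := exists_tsum_gaussian_shift_le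
    (c := t * (2 * Real.pi ^ 2 * (1 + α ^ 2)⁻¹)) (by positivity)
  refine ⟨K, hK0, fun h hh => ?_⟩
  set m := min 1 h with hm
  have hm0 : 0 < m := lt_min one_pos hh
  have hsum := (hasSum_riemann (c := t * Real.pi ^ 2) (by positivity)
    (measurable_gaussian (t * Real.pi ^ 2)) gaussian_self_bound hm0).summable
  rw [ENNReal.ofReal_mul hK0, ENNReal.ofReal_tsum_of_nonneg (fun l => by positivity) hsum,
    ← ENNReal.tsum_mul_left, torusTrace]
  refine ENNReal.tsum_le_tsum fun l => ?_
  calc ∑' k : ℤ, ENNReal.ofReal (Real.exp (-t * torusEigenvalue α h l k))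
      ≤ ∑' k : ℤ, ENNReal.ofReal (Real.exp (-(t * Real.pi ^ 2) * (m * l) ^ 2)) *
          ENNReal.ofReal (Real.exp (-(t * (2 * Real.pi ^ 2 * (1 + α ^ 2)⁻¹))
            * (k + α * l) ^ 2)) := by
        refine ENNReal.tsum_le_tsum fun k => ?_
        rw [← ENNReal.ofReal_mul (Real.exp_nonneg _), ← Real.exp_add]
        refine ENNReal.ofReal_le_ofReal (Real.exp_le_exp.2 ?_)
        have := mul_le_mul_of_nonneg_left
          (torusEigenvalue_ge α hm0.le (min_le_left _ _) (min_le_right 1 h) l k) ht.le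
        nlinarith
    _ ≤ _ := by
        rw [ENNReal.tsum_mul_left, mul_comm]
        gcongr
        exact hK _

theorem torusTrace_ne_top (α : ℝ) {t h : ℝ} (ht : 0 < t) (hh : 0 < h) : torusTrace α h t ≠ ⊤ := by
  obtain ⟨K, -, hK⟩ := exists_torusTrace_le α ht
  exact ne_top_of_le_ne_top ENNReal.ofReal_ne_top (hK h hh)

theorem tendsto_sq_mul_torusTrace (α : ℝ) {t : ℝ} (ht : 0 < t) :
    Tendsto (fun h : ℝ => h ^ 2 * (torusTrace α h t).toReal) (𝓝[>] 0) (𝓝 0) := by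
  have hpi := Real.pi_pos
  obtain ⟨K, hK0, hK⟩ := exists_torusTrace_le α ht
  have hr := tendsto_riemann (c := t * Real.pi ^ 2) (by positivity)
    (measurable_gaussian (t * Real.pi ^ 2)) gaussian_self_bound
    (fun x _ => Continuous.continuousAt (by fun_prop))
  have hid : Tendsto (fun h : ℝ => h) (𝓝[>] 0) (𝓝 0) :=
    tendsto_nhdsWithin_of_tendsto_nhds tendsto_id
  have h0 := (hid.mul_const K).mul hr
  rw [zero_mul, zero_mul] at h0
  refine squeeze_zero' (Eventually.of_forall fun h => by positivity) ?_ h0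
  have : ∀ᶠ a : ℝ in 𝓝[>] 0, a ∈ Set.Ioc (0 : ℝ) 1 := Ioc_mem_nhdsGT one_pos
  filter_upwards [this] with h hh
  have h1 := ENNReal.toReal_mono ENNReal.ofReal_ne_top (hK h hh.1)
  rw [ENNReal.toReal_ofReal (mul_nonneg hK0 (tsum_nonneg fun l => by positivity)),
    min_eq_right hh.2] at h1
  calc h ^ 2 * (torusTrace α h t).toReal
      ≤ h ^ 2 * (K * ∑' l : ℤ, Real.exp (-(t * Real.pi ^ 2) * (h * l) ^ 2)) := by gcongr
    _ = _ := by ring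

end HeisAdiabatic

end

/-! ### The asymptotics of the heat trace -/

theorem theorem1p6 (α t : ℝ) (ht : 0 < t) :
    (∀ h : ℝ, 0 < h → HeisAdiabatic.heatTrace α h t ≠ ⊤) ∧
    Integrable (fun η : ℝ => η / Real.sinh (t * η) * Real.exp (-t * η ^ 2)) volume ∧
    (fun h : ℝ => (HeisAdiabatic.heatTrace α h t).toReal
        - (h ^ 2)⁻¹ / (8 * Real.pi ^ 2)
          * ∫ η : ℝ, η / Real.sinh (t * η) * Real.exp (-t * η ^ 2))
      =o[𝓝[>] 0] fun h : ℝ => (h ^ 2)⁻¹ := by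
  open HeisAdiabatic in
  have hpi := Real.pi_pos
  have hsum : ∀ h : ℝ, 0 < h → Summable fun n : ℤ =>
      (4 * Real.pi * h)⁻¹ * density t (2 * Real.pi * h * n) := fun h hh =>
    ((hasSum_riemann ht (measurable_density t) (abs_density_le ht)
      (by positivity : 0 < 2 * Real.pi * h)).summable).mul_left _
  have htr : ∀ h : ℝ, 0 < h → heatTrace α h t = torusTrace α h t
      + ENNReal.ofReal ((4 * Real.pi * h)⁻¹ * ∑' n : ℤ, density t (2 * Real.pi * h * n)) := by
    intro h hh
    rw [heatTrace_eq α ht hh, ← tsum_mul_left, ENNReal.ofReal_tsum_of_nonneg _ (hsum h hh)]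
    exact fun n => mul_nonneg (by positivity) (density_nonneg ht _)
  refine ⟨fun h hh => ?_, ?_, ?_⟩
  · rw [htr h hh]
    exact ENNReal.add_ne_top.2 ⟨torusTrace_ne_top α ht hh, ENNReal.ofReal_ne_top⟩
  · exact integrable_of_gaussian_bound ht (measurable_density t) (abs_density_le ht)
  · change (fun h : ℝ => (heatTrace α h t).toReal
        - (h ^ 2)⁻¹ / (8 * Real.pi ^ 2) * ∫ η : ℝ, density t η) =o[𝓝[>] 0] _
    rw [isLittleO_iff_tendsto']
    · have hscale : Tendsto (fun h : ℝ => 2 * Real.pi * h) (𝓝[>] 0) (𝓝[>] 0) := by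
        refine tendsto_nhdsWithin_iff.2 ⟨?_, ?_⟩
        · refine tendsto_nhdsWithin_of_tendsto_nhds ?_
          exact (Continuous.tendsto' (by fun_prop) _ _ (by simp))
        · filter_upwards [self_mem_nhdsWithin] with h hh
          have : 0 < h := hh
          exact Set.mem_Ioi.2 (by positivity)
      have hr := (tendsto_riemann ht (measurable_density t) (abs_density_le ht)
        (fun x hx => continuousAt_density ht hx)).comp hscale
      -- The constant comes from `h² (4πh)⁻¹ = (8π²)⁻¹ (2πh)`, where `2πh` is the step of the
      -- Riemann sum.
      have h1 := ((tendsto_sq_mul_torusTrace α ht).add (hr.const_mul (8 * Real.pi ^ 2)⁻¹)).sub_const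
        ((8 * Real.pi ^ 2)⁻¹ * ∫ η : ℝ, density t η)
      rw [zero_add, sub_self] at h1
      refine h1.congr' ?_
      filter_upwards [self_mem_nhdsWithin] with h hh
      have hh' : 0 < h := hh
      rw [htr h hh', ENNReal.toReal_add (torusTrace_ne_top α ht hh') ENNReal.ofReal_ne_top,
        ENNReal.toReal_ofReal (mul_nonneg (by positivity)
          (tsum_nonneg fun n => density_nonneg ht _))]
      simp only [Function.comp]
      field_simp
      ring
    · filter_upwards [self_mem_nhdsWithin] with h hh h0
      have hh' : 0 < h := hh
      have : (h ^ 2)⁻¹ ≠ 0 := by positivity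
      exact absurd h0 this
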